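/- **Theorem 3.1 (General Transport Bound).** For a real sequence $\{V_n\}\in\ell^\infty(\mathbb Z)$ and complex numbers $(A_m)_{m\in\mathbb Z}$ with $\overline{A_m}=A_{-m}$ and $|A_m|\le C_1e^{-c_1|m|}$ for all $m$, consider the bounded self-adjoint operator on $\ell^2(\mathbb Z)$ $$(H\psi)_n=\sum_{m\in\mathbb Z}A_m\psi_{n-m}+V_n\psi_n .$$ For a finite interval $I\subseteq\mathbb Z$ let $|I|$ be its number of points, $R_I$ the restriction to $I$, and $G_I(z)=(R_I(H-z)R_I)^{-1}$ for non-real $z$. For $\phi\in\ell^2(\mathbb Z)$, $p>0$, $T>0$ put $$\langle |X_H|^p_\phi\rangle(T)=\frac2T\int_0^\infty e^{-2t/T}\sum_{n\in\mathbb Z}|n|^p\,\big|(e^{-itH}\phi)_n\big|^2\,dt\in[0,\infty].$$ Let $\phi\in\ell^2(\mathbb Z)$ be finitely supported, and let $K\ge3$, $C_1\in\mathbb R$, $C_2>1$, $0<c_2\le c_1$, $\epsilon_0>0$, $p>0$ and an integer $N_0\ge1$ be given. Then there is $T_0>0$, depending only on $\phi,K,C_1,C_2,c_1,c_2,\epsilon_0,p,N_0$,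 such that the following holds for every $H$ as above with $\sigma(H)\subseteq[-K+1,K-1]$. Let $\Psi:[N_0,\infty)\to\mathbb R$ be strictly increasing, with inverse function $\Gamma:[\Psi(N_0),\infty)\to[N_0,\infty)$ (so $\Psi$ maps onto $[\Psi(N_0),\infty)$). Suppose $\Psi(|N|)\ge(\log|N|)^{C_2}$ for every integer $N$ with $|N|\ge N_0$, and suppose that for every such $N$ and every $z=E+i\epsilon$ with $|E|\le K$ and $0<\epsilon\le\epsilon_0$ there is an interval $I$ of integers (which may depend on $N$ and $z$) such that 1. $I\subseteq[\frac N4,\frac N2]$ if $N>0$, and $I\subseteq[-\frac{|N|}2,-\frac{|N|}4]$ if $N<0$; 2. $|I|\ge\Psi(|N|)$; 3. $|G_I(z)(m,n)|<e^{-c_2|I|}$ for all $m,n\in I$ with $|m-n|>\frac{|I|}{20}$. Then for all $T\ge T_0$, $$\langle |X_H|^p_\phi\rangle(T)\le\|\phi\|^2\Big[\Gamma\Big(\frac{80}{c_2}\log T\Big)\Big]^p ,$$ that is, $\langle |X_H|^p_\phi\rangle(T)\le\big[\Gamma\big(\frac{80}{c_2}\log T\big)\big]^p$ for a normalized initial state,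 $\|\phi\|=1$. -/

import Mathlib

open MeasureTheory Set
open scoped ENNReal

/-- The Hilbert space `ℓ²(ℤ)` of square-summable complex sequences. -/
abbrev EllTwo : Type := lp (fun _ : ℤ => ℂ) 2

/-- The space `ℓ^∞(ℤ)` of bounded real sequences. -/
abbrev EllInfty : Type := lp (fun _ : ℤ => ℝ) ∞

theorem ellTwo_summable_sq (f : EllTwo) : Summable fun n : ℤ => ‖f n‖ ^ (2 : ℝ) := by
  simpa using (lp.memℓp f).summable (by norm_num)

theorem ellTwo_norm_sq (f : EllTwo) : ‖f‖ ^ (2 : ℝ) = ∑' n : ℤ, ‖f n‖ ^ (2 : ℝ) := by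
  simpa using lp.norm_rpow_eq_tsum (p := 2) (by norm_num) f

/-- The translation `(S_m ψ)_n = ψ_{n-m}` on `ℓ²(ℤ)`. -/
noncomputable def shiftOp (m : ℤ) : EllTwo →L[ℂ] EllTwo :=
  LinearMap.mkContinuous
    { toFun := fun f => ⟨fun n => f (n - m), by
        refine memℓp_gen ?_
        simpa [Function.comp_def] using
          (ellTwo_summable_sq f).comp_injective (sub_left_injective (b := m))⟩
      map_add' := fun _ _ => rfl
      map_smul' := fun _ _ => rfl }
    1
    (fun f => by
      rw [one_mul]
      refine lp.norm_le_of_tsum_le (p := 2) (by norm_num) (norm_nonneg _) (le_of_eq ?_)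
      exact ((Equiv.subRight m).tsum_eq fun n : ℤ => ‖f n‖ ^ (2 : ℝ≥0∞).toReal).trans
        (lp.norm_rpow_eq_tsum (p := 2) (by norm_num) f).symm)

@[simp] theorem shiftOp_apply (m : ℤ) (f : EllTwo) (n : ℤ) : shiftOp m f n = f (n - m) := rfl

theorem norm_shiftOp_le (m : ℤ) : ‖shiftOp m‖ ≤ 1 :=
  LinearMap.mkContinuous_norm_le _ zero_le_one _

theorem potential_mul_sq_le (V : EllInfty) (f : EllTwo) (n : ℤ) :
    ‖(V n : ℂ) * f n‖ ^ (2 : ℝ) ≤ ‖V‖ ^ (2 : ℝ) * ‖f n‖ ^ (2 : ℝ) := by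
  rw [norm_mul, Real.mul_rpow (norm_nonneg _) (norm_nonneg _), Complex.norm_real]
  have := lp.norm_apply_le_norm (p := ∞) (by simp) V n
  gcongr

/-- Multiplication by a bounded real potential, `(V ψ)_n = V_n ψ_n`, on `ℓ²(ℤ)`. -/
noncomputable def potentialOp (V : EllInfty) : EllTwo →L[ℂ] EllTwo :=
  LinearMap.mkContinuous
    { toFun := fun f => ⟨fun n => (V n : ℂ) * f n, by
        refine memℓp_gen ?_
        simpa using ((ellTwo_summable_sq f).mul_left (‖V‖ ^ (2 : ℝ))).of_nonneg_of_le
          (fun n => by positivity) (potential_mul_sq_le V f)⟩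
      map_add' := fun f g => lp.ext (funext fun n => mul_add (V n : ℂ) (f n) (g n))
      map_smul' := fun c f => lp.ext (funext fun n => mul_left_comm (V n : ℂ) c (f n)) }
    ‖V‖
    (fun f => by
      refine lp.norm_le_of_tsum_le (p := 2) (by norm_num) (by positivity) ?_
      have hs := (ellTwo_summable_sq f).mul_left (‖V‖ ^ (2 : ℝ))
      have h := Summable.tsum_le_tsum (potential_mul_sq_le V f)
        (hs.of_nonneg_of_le (fun n => by positivity) (potential_mul_sq_le V f)) hs
      rw [tsum_mul_left, ← ellTwo_norm_sq, ← Real.mul_rpow (norm_nonneg _) (norm_nonneg _)] at h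
      simpa using h)

@[simp] theorem potentialOp_apply (V : EllInfty) (f : EllTwo) (n : ℤ) :
    potentialOp V f n = (V n : ℂ) * f n := rfl

/-- The long-range operator `(H ψ)_n = ∑_m A_m ψ_{n-m} + V_n ψ_n` on `ℓ²(ℤ)`. The sum over `m`
converges in operator norm when `A` decays exponentially, see `longRangeOp_apply`. -/
noncomputable def longRangeOp (A : ℤ → ℂ) (V : EllInfty) : EllTwo →L[ℂ] EllTwo :=
  (∑' m : ℤ, A m • shiftOp m) + potentialOp V

theorem summable_exp_neg_abs {c : ℝ} (hc : 0 < c) :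
    Summable fun m : ℤ => Real.exp (-c * |(m : ℝ)|) := by
  have h : Summable fun n : ℕ => Real.exp (-c * n) := by
    simpa [mul_comm] using Real.summable_exp_nat_mul_iff.mpr (neg_neg_of_pos hc)
  refine Summable.of_nat_of_neg ?_ ?_ <;> simpa using h

theorem summable_hopping {A : ℤ → ℂ} {C c : ℝ} (hc : 0 < c)
    (hA : ∀ m : ℤ, ‖A m‖ ≤ C * Real.exp (-c * |(m : ℝ)|)) :
    Summable fun m : ℤ => A m • shiftOp m := by
  refine Summable.of_norm_bounded ((summable_exp_neg_abs hc).mul_left C) fun m => ?_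
  rw [norm_smul]
  exact (mul_le_of_le_one_right (norm_nonneg _) (norm_shiftOp_le m)).trans (hA m)

theorem longRangeOp_apply {A : ℤ → ℂ} {C c : ℝ} (hc : 0 < c)
    (hA : ∀ m : ℤ, ‖A m‖ ≤ C * Real.exp (-c * |(m : ℝ)|)) (V : EllInfty) (f : EllTwo) (n : ℤ) :
    longRangeOp A V f n = (∑' m : ℤ, A m * f (n - m)) + (V n : ℂ) * f n := by
  let L : (EllTwo →L[ℂ] EllTwo) →L[ℂ] ℂ :=
    (lp.evalCLM ℂ (fun _ : ℤ => ℂ) 2 n).comp (ContinuousLinearMap.apply ℂ EllTwo f)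
  have h : L (∑' m : ℤ, A m • shiftOp m) = ∑' m : ℤ, A m * f (n - m) :=
    L.map_tsum (summable_hopping hc hA)
  exact congrArg (· + (V n : ℂ) * f n) h

/-- The canonical basis vector `δ_n` of `ℓ²(ℤ)`. -/
noncomputable def basisVec (n : ℤ) : EllTwo := lp.single 2 n 1

/-- The restriction `R_I H R_I` of an operator to a finite set `I ⊆ ℤ`, as the matrix with entries
`⟨δ_m, H δ_n⟩`, `m, n ∈ I`. -/
noncomputable def boxMatrix (H : EllTwo →L[ℂ] EllTwo) (I : Finset ℤ) : Matrix I I ℂ :=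
  Matrix.of fun m n => H (basisVec n) (m : ℤ)

/-- The Green's function `G_I(z) = (R_I (H - z) R_I)⁻¹` of the box `I`. (For self-adjoint `H` and
non-real `z` the matrix is invertible.) -/
noncomputable def boxGreen (H : EllTwo →L[ℂ] EllTwo) (I : Finset ℤ) (z : ℂ) : Matrix I I ℂ :=
  (boxMatrix H I - z • (1 : Matrix I I ℂ))⁻¹

/-- The solution `ψ(t) = e^{-itH} φ` of `i ∂ₜ ψ = H ψ`, `ψ(0) = φ`. -/
noncomputable def evolve (H : EllTwo →L[ℂ] EllTwo) (t : ℝ) (φ : EllTwo) : EllTwo :=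
  NormedSpace.exp ((-(Complex.I * (t : ℂ))) • H) φ

/-- The time-averaged `p`-th moment of the position operator,
`(2/T) ∫₀^∞ e^{-2t/T} ⟨ψ(t), |X|^p ψ(t)⟩ dt` with `⟨ψ, |X|^p ψ⟩ = ∑_n |n|^p |ψ_n|²`,
as an element of `[0, ∞]`. -/
noncomputable def averagedMoment (H : EllTwo →L[ℂ] EllTwo) (p : ℝ) (φ : EllTwo) (T : ℝ) : ℝ≥0∞ :=
  ENNReal.ofReal (2 / T) * ∫⁻ t in Ioi (0 : ℝ), ENNReal.ofReal (Real.exp (-2 * t / T)) *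
    ∑' n : ℤ, ENNReal.ofReal (|(n : ℝ)| ^ p * ‖evolve H t φ n‖ ^ 2)

/-- The interval `[a, b] ∩ ℤ` lies in `[N/4, N/2]` if `N > 0`, and in `[-|N|/2, -|N|/4]` if
`N < 0`. -/
def IsBetween (a b N : ℤ) : Prop :=
  (0 < N ∧ (N : ℝ) / 4 ≤ a ∧ (b : ℝ) ≤ N / 2) ∨ (N < 0 ∧ (N : ℝ) / 2 ≤ a ∧ (b : ℝ) ≤ N / 4)

/-- `I` is a good box for `H` at the spectral parameter `z`: the Green's function satisfies
`|G_I(z)(m, n)| < e^{-c |I|}` whenever `m, n ∈ I` and `|m - n| > |I| / 20`. -/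
def IsGoodBox (H : EllTwo →L[ℂ] EllTwo) (c : ℝ) (z : ℂ) (I : Finset ℤ) : Prop :=
  ∀ m n : I, (I.card : ℝ) / 20 < |((m : ℤ) : ℝ) - ((n : ℤ) : ℝ)| →
    ‖boxGreen H I z m n‖ < Real.exp (-c * I.card)

/-! The evolution is a Cauchy integral of the resolvent over the boundary of `[-K, K] × [-δ, δ]`
with `δ = 1/(2T)`. Decay of the resolvent of `H` applied to `φ` along this contour therefore becomes
decay of `ψ(t)`, at the cost of a factor `e^{tδ}` (`rectIntegral_exp_resolvent`,
`norm_evolve_apply_le`).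

On the contour the numerical range of `H` stays at distance at least `δ` from `z`: on the horizontal
sides because `|Im z| = δ`, on the vertical ones because `‖H‖ ≤ K - 1`. Such a quadratic-form bound
is inherited by vectors supported on any set of sites, so it controls both box matrices and
half-lines. Let a good box `I` separate the site `n` from the source. The Green's function makes the
solution `x` small near the centre of `I` (`IsGoodBox.norm_apply_le`). Hopping is long-range, so
smallness at the centre does not by itself cut the line. But on the half-line behind the centre, `H
- z` applied to the restriction of `x` is only the hopping across the centre, which is exponentially
small; the quadratic-form bound then makes that whole restriction small (`norm_cutoff_le`). The
result is a bound of order `δ⁻³ e^{-3c|I|/40}` (`norm_apply_le_of_goodBox`).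

Put `R = Γ((80/c₂) log T)`. If `|n| ≥ R/2`, the box for `N = 2n` lies between the support of `φ` and
`n`, and `|I| ≥ Ψ(2|n|) ≥ Ψ(R) = (80/c₂) log T`. Two thirds of the exponent give `T⁻⁴`, which beats
`δ⁻³ = 8T³`; the last third gives `e^{-(c₂/40)(log 2|n|)^{C₂}}`, whose square is summable against
`|n|^p` since `C₂ > 1`. Sites with `|n| < R/2` contribute at most `(R/2)^p ‖φ‖²`, and the `O(T⁻²)
‖φ‖²` from the others fits into the gap `R^p - (R/2)^p`. -/

/-! ### Contour integrals over a rectangle -/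

/-- The integral of `f` over the boundary of the rectangle `[-K, K] × [-δ, δ]`, counterclockwise. -/
noncomputable def rectIntegral {E : Type*} [NormedAddCommGroup E] [NormedSpace ℂ E]
    (K δ : ℝ) (f : ℂ → E) : E :=
  (∫ s in -K..K, f (s + (-δ : ℝ) * Complex.I)) - (∫ s in -K..K, f (s + δ * Complex.I))
    + Complex.I • (∫ s in -δ..δ, f (K + s * Complex.I))
    - Complex.I • (∫ s in -δ..δ, f ((-K : ℝ) + s * Complex.I))

theorem rectIntegral_eq_zero {K δ : ℝ} {f : ℂ → ℂ} (hf : Differentiable ℂ f) :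
    rectIntegral K δ f = 0 := by
  simpa [rectIntegral] using Complex.integral_boundary_rect_eq_zero_of_differentiableOn f
    ((-K : ℝ) + (-δ : ℝ) * Complex.I) (K + δ * Complex.I) hf.differentiableOn

theorem integral_inv_line_eq_log {a b : ℝ} {w v : ℂ}
    (h : ∀ s : ℝ, w + s * v ∈ Complex.slitPlane) :
    v * (∫ s in a..b, (w + s * v)⁻¹) = Complex.log (w + b * v) - Complex.log (w + a * v) := by
  rw [← intervalIntegral.integral_const_mul]
  refine intervalIntegral.integral_eq_sub_of_hasDerivAt
    (f := fun s : ℝ => Complex.log (w + s * v)) (fun s _ => ?_) ?_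
  · have h1 : HasDerivAt (fun s : ℝ => w + s * v) v s := by
      simpa using ((Complex.ofRealCLM.hasDerivAt (x := s)).mul_const v).const_add w
    simpa [div_eq_mul_inv] using h1.clog_real (h s)
  · refine Continuous.intervalIntegrable ?_ _ _
    exact continuous_const.mul
      (Continuous.inv₀ (by fun_prop) fun s => Complex.slitPlane_ne_zero (h s))

theorem log_neg_of_im_pos {w : ℂ} (h : 0 < w.im) :
    Complex.log (-w) = Complex.log w - Real.pi * Complex.I := by
  simp only [Complex.log, norm_neg, Complex.arg_neg_eq_arg_sub_pi_of_im_pos h]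
  push_cast; ring

theorem log_neg_of_im_neg {w : ℂ} (h : w.im < 0) :
    Complex.log (-w) = Complex.log w + Real.pi * Complex.I := by
  simp only [Complex.log, norm_neg, Complex.arg_neg_eq_arg_add_pi_of_im_neg h]
  push_cast; ring

/-- Each side is integrated with the principal logarithm. The contributions cancel at the two right
corners; at the two left corners `log(-w)` differs from `log w` by `∓πi`, which adds up to `2πi`. -/
theorem rectIntegral_inv {K δ x : ℝ} (hδ : 0 < δ) (h1 : -K < x) (h2 : x < K) :
    rectIntegral K δ (fun z => (z - x)⁻¹) = 2 * Real.pi * Complex.I := by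
  have hB := integral_inv_line_eq_log (a := -K) (b := K) (w := -x + (-δ : ℝ) * Complex.I) (v := 1)
    (fun s => Or.inr (by simpa using hδ.ne'))
  have hT := integral_inv_line_eq_log (a := -K) (b := K) (w := -x + δ * Complex.I) (v := 1)
    (fun s => Or.inr (by simpa using hδ.ne'))
  have hR := integral_inv_line_eq_log (a := -δ) (b := δ) (w := K - x) (v := Complex.I)
    (fun s => Or.inl (by simpa using h2))
  -- On the left side `z - x` crosses the branch cut, so the logarithm of `-(z - x)` is used
  -- instead.
  have hL := integral_inv_line_eq_log (a := -δ) (b := δ) (w := K + x) (v := -Complex.I)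
    (fun s => Or.inl (by simp; linarith))
  have e3 := log_neg_of_im_pos (w := K + x + δ * Complex.I) (by simpa using hδ)
  have e4 := log_neg_of_im_neg (w := K + x + -δ * Complex.I) (by simpa using hδ)
  have hL' : (∫ s in -δ..δ, ((K : ℂ) + x + s * -Complex.I)⁻¹)
      = -∫ s in -δ..δ, (((-K : ℝ) : ℂ) + s * Complex.I - x)⁻¹ := by
    rw [← intervalIntegral.integral_neg]
    congr 1; ext s
    rw [← inv_neg]; congr 1; push_cast; ring
  rw [hL'] at hL
  simp only [one_mul, mul_one] at hB hT
  have c1 : (∫ s in -K..K, ((s : ℂ) + (-δ : ℝ) * Complex.I - x)⁻¹)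
      = ∫ s in -K..K, (-(x : ℂ) + (-δ : ℝ) * Complex.I + s)⁻¹ := by
    congr 1; ext s; congr 1; ring
  have c2 : (∫ s in -K..K, ((s : ℂ) + δ * Complex.I - x)⁻¹)
      = ∫ s in -K..K, (-(x : ℂ) + δ * Complex.I + s)⁻¹ := by
    congr 1; ext s; congr 1; ring
  have c3 : (∫ s in -δ..δ, ((K : ℂ) + s * Complex.I - x)⁻¹)
      = ∫ s in -δ..δ, ((K : ℂ) - x + s * Complex.I)⁻¹ := by
    congr 1; ext s; congr 1; ring
  simp only [rectIntegral, smul_eq_mul]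
  rw [c1, c2, c3, hB, hT, hR]
  rw [neg_mul_neg] at hL
  rw [hL]
  push_cast
  rw [show -(x : ℂ) + -δ * Complex.I + K = K - x + -δ * Complex.I by ring,
    show -(x : ℂ) + δ * Complex.I + K = K - x + δ * Complex.I by ring,
    show -(x : ℂ) + -δ * Complex.I + -K = -(K + x + δ * Complex.I) by ring,
    show -(x : ℂ) + δ * Complex.I + -K = -(K + x + -δ * Complex.I) by ring, e3, e4,
    show (K : ℂ) + x + δ * -Complex.I = K + x + -δ * Complex.I by ring,
    show (K : ℂ) + x + -δ * -Complex.I = K + x + δ * Complex.I by ring]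
  ring

theorem rectIntegral_congr {E : Type*} [NormedAddCommGroup E] [NormedSpace ℂ E] {K δ : ℝ}
    {f g : ℂ → E} (hδ : δ ≠ 0)
    (h : ∀ z : ℂ, (z.im ≠ 0 ∨ |z.re| = |K|) → f z = g z) :
    rectIntegral K δ f = rectIntegral K δ g := by
  have h1 : ∀ s : ℝ, f (s + (-δ : ℝ) * Complex.I) = g (s + (-δ : ℝ) * Complex.I) :=
    fun s => h _ (Or.inl (by simpa using hδ))
  have h2 : ∀ s : ℝ, f (s + δ * Complex.I) = g (s + δ * Complex.I) :=
    fun s => h _ (Or.inl (by simpa using hδ))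
  have h3 : ∀ s : ℝ, f (K + s * Complex.I) = g (K + s * Complex.I) :=
    fun s => h _ (Or.inr (by simp))
  have h4 : ∀ s : ℝ, f ((-K : ℝ) + s * Complex.I) = g ((-K : ℝ) + s * Complex.I) :=
    fun s => h _ (Or.inr (by simp))
  simp only [rectIntegral, h1, h2, h3, h4]

/-- **Cauchy's integral formula** for a rectangle and an entire function. -/
theorem rectIntegral_cauchy {K δ x : ℝ} (hδ : 0 < δ) (h1 : -K < x) (h2 : x < K)
    {f : ℂ → ℂ} (hf : Differentiable ℂ f) :
    rectIntegral K δ (fun z => f z * (z - x)⁻¹) = 2 * Real.pi * Complex.I * f x := by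
  -- The difference quotient of `f` at `x` extends to an entire function, so its contour integral
  -- vanishes and only the winding integral remains.
  have hd : Differentiable ℂ (dslope f x) := by
    rw [← differentiableOn_univ] at hf ⊢
    exact (Complex.differentiableOn_dslope Filter.univ_mem).mpr hf
  have hz : ∀ z : ℂ, (z.im ≠ 0 ∨ |z.re| = |K|) → z - x ≠ 0 := by
    intro z hz h0
    have : z = x := sub_eq_zero.mp h0
    subst this
    have := abs_lt.mpr ⟨h1, h2⟩
    have := le_abs_self K
    simp at hz
    linarith
  have e : rectIntegral K δ (dslope f x)
      = rectIntegral K δ (fun z => f z * (z - x)⁻¹ - f x * (z - x)⁻¹) := by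
    refine rectIntegral_congr hδ.ne' fun z h => ?_
    rw [dslope_of_ne _ (sub_ne_zero.mp (hz z h)), slope_def_field, div_eq_mul_inv, sub_mul]
  rw [rectIntegral_eq_zero hd] at e
  have hc : ∀ γ : ℝ → ℂ, Continuous γ → (∀ s, (γ s).im ≠ 0 ∨ |(γ s).re| = |K|) →
      ∀ g : ℂ → ℂ, Continuous g → ∀ a b : ℝ,
      IntervalIntegrable (fun s => g (γ s) * (γ s - x)⁻¹) volume a b := by
    intro γ hγ h g hg a b
    exact ((hg.comp hγ).mul ((hγ.sub continuous_const).inv₀ fun s => hz _ (h s))).intervalIntegrable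
      _ _
  have key : rectIntegral K δ (fun z => f z * (z - x)⁻¹ - f x * (z - x)⁻¹)
      = rectIntegral K δ (fun z => f z * (z - x)⁻¹)
        - f x * rectIntegral K δ (fun z => (z - x)⁻¹) := by
    have p1 : ∀ s : ℝ, ((s : ℂ) + (-δ : ℝ) * Complex.I).im ≠ 0
      ∨ |((s : ℂ) + (-δ : ℝ) * Complex.I).re| = |K| := fun s => Or.inl (by simpa using hδ.ne')
    have p2 : ∀ s : ℝ, ((s : ℂ) + δ * Complex.I).im ≠ 0
      ∨ |((s : ℂ) + δ * Complex.I).re| = |K| := fun s => Or.inl (by simpa using hδ.ne')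
    have p3 : ∀ s : ℝ, ((K : ℂ) + s * Complex.I).im ≠ 0
      ∨ |((K : ℂ) + s * Complex.I).re| = |K| := fun s => Or.inr (by simp)
    have p4 : ∀ s : ℝ, (((-K : ℝ) : ℂ) + s * Complex.I).im ≠ 0
      ∨ |(((-K : ℝ) : ℂ) + s * Complex.I).re| = |K| := fun s => Or.inr (by simp)
    simp only [rectIntegral]
    rw [intervalIntegral.integral_sub (hc _ (by fun_prop) p1 f hf.continuous _ _)
        (hc _ (by fun_prop) p1 (fun _ => f x) continuous_const _ _),
      intervalIntegral.integral_sub (hc _ (by fun_prop) p2 f hf.continuous _ _)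
        (hc _ (by fun_prop) p2 (fun _ => f x) continuous_const _ _),
      intervalIntegral.integral_sub (hc _ (by fun_prop) p3 f hf.continuous _ _)
        (hc _ (by fun_prop) p3 (fun _ => f x) continuous_const _ _),
      intervalIntegral.integral_sub (hc _ (by fun_prop) p4 f hf.continuous _ _)
        (hc _ (by fun_prop) p4 (fun _ => f x) continuous_const _ _)]
    simp only [intervalIntegral.integral_const_mul, smul_eq_mul]
    ring
  rw [key, rectIntegral_inv hδ h1 h2] at e
  linear_combination -e

/-- The midpoints of the vertical sides form a null set and need no bound; they are real, and good
boxes are assumed only off the real axis. -/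
theorem norm_rectIntegral_le {E : Type*} [NormedAddCommGroup E] [NormedSpace ℂ E] {K δ B : ℝ}
    {f : ℂ → E} (hK : 0 ≤ K) (hδ : 0 < δ)
    (h1 : ∀ s : ℝ, |s| ≤ K → ‖f (s + (-δ : ℝ) * Complex.I)‖ ≤ B)
    (h2 : ∀ s : ℝ, |s| ≤ K → ‖f (s + δ * Complex.I)‖ ≤ B)
    (h3 : ∀ s : ℝ, s ≠ 0 → |s| ≤ δ → ‖f (K + s * Complex.I)‖ ≤ B)
    (h4 : ∀ s : ℝ, s ≠ 0 → |s| ≤ δ → ‖f ((-K : ℝ) + s * Complex.I)‖ ≤ B) :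
    ‖rectIntegral K δ f‖ ≤ (4 * K + 4 * δ) * B := by
  have aux : ∀ r : ℝ, 0 ≤ r → ∀ g : ℝ → E, (∀ s, s ≠ 0 → |s| ≤ r → ‖g s‖ ≤ B) →
      ‖∫ s in -r..r, g s‖ ≤ B * (2 * r) := by
    intro r hr g hg
    have := intervalIntegral.norm_integral_le_of_norm_le_const_ae (a := -r) (b := r) (C := B)
      (f := g) ?_
    · rwa [abs_of_nonneg (by linarith), show r - -r = 2 * r by ring] at this
    · filter_upwards [Measure.ae_ne volume (0 : ℝ)] with s hs hs2
      rw [uIoc_of_le (by linarith)] at hs2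
      exact hg s hs (abs_le.mpr ⟨hs2.1.le, hs2.2⟩)
  have a1 := aux K hK _ fun s _ => h1 s
  have a2 := aux K hK _ fun s _ => h2 s
  have a3 := aux δ hδ.le _ h3
  have a4 := aux δ hδ.le _ h4
  unfold rectIntegral
  refine (norm_sub_le _ _).trans ?_
  have b1 := norm_add_le ((∫ s in -K..K, f (s + (-δ : ℝ) * Complex.I))
    - (∫ s in -K..K, f (s + δ * Complex.I))) (Complex.I • (∫ s in -δ..δ, f (K + s * Complex.I)))
  have b2 := norm_sub_le (∫ s in -K..K, f (s + (-δ : ℝ) * Complex.I))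
    (∫ s in -K..K, f (s + δ * Complex.I))
  rw [norm_smul, Complex.norm_I, one_mul] at b1 ⊢
  linarith

/-! ### Cauchy's formula in a C*-algebra -/

section
variable {A : Type*} [CStarAlgebra A]

theorem cfc_inv_sub_eq_resolvent {a : A} [IsStarNormal a] {w z : ℂ} (hz : z ∉ spectrum ℂ a) :
    cfc (fun x => w * (z - x)⁻¹) a = w • resolvent a z := by
  have h0 : ∀ x ∈ spectrum ℂ a, z - x ≠ 0 := fun x hx h => hz ((sub_eq_zero.mp h) ▸ hx)
  rw [cfc_const_mul w (fun x => (z - x)⁻¹) a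
      ((by fun_prop : ContinuousOn (fun x => z - x) _).inv₀ h0),
    cfc_inv _ a h0, cfc_sub .., cfc_const .., cfc_id' .., resolvent]

theorem continuous_uncurry_cauchyKernel {S : Set ℂ} {γ g : ℝ → ℂ} (hγ : Continuous γ)
    (hg : Continuous g) (h : ∀ s, γ s ∉ S) :
    Continuous (Function.uncurry fun (x : S) (s : ℝ) => g s * (γ s - x)⁻¹) := by
  refine (hg.comp continuous_snd).mul (Continuous.inv₀ (by fun_prop) ?_)
  rintro ⟨x, s⟩ h0
  exact h s ((sub_eq_zero.mp h0) ▸ x.2)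

theorem continuousOn_integral_cauchyKernel {S : Set ℂ} {γ g : ℝ → ℂ} (hγ : Continuous γ)
    (hg : Continuous g) (h : ∀ s, γ s ∉ S) (u v : ℝ) :
    ContinuousOn (fun x : ℂ => ∫ s in u..v, g s * (γ s - x)⁻¹) S := by
  rw [continuousOn_iff_continuous_domRestrict]
  exact intervalIntegral.continuous_parametric_intervalIntegral_of_continuous'
    (continuous_uncurry_cauchyKernel hγ hg h) u v

/-- The Cauchy kernel is continuous, hence bounded, on the compact product of the interval with the
spectrum; this allows exchanging the functional calculus with the integral. -/
theorem cfc_integral_cauchyKernel {a : A} [IsStarNormal a] {γ g : ℝ → ℂ} (hγ : Continuous γ)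
    (hg : Continuous g) (h : ∀ s, γ s ∉ spectrum ℂ a) {u v : ℝ} (huv : u ≤ v) :
    cfc (fun x : ℂ => ∫ s in u..v, g s * (γ s - x)⁻¹) a
      = ∫ s in u..v, g s • resolvent a (γ s) := by
  have hc : ContinuousOn (Function.uncurry fun (s : ℝ) (x : ℂ) => g s * (γ s - x)⁻¹)
      (univ ×ˢ spectrum ℂ a) := by
    refine ((hg.comp continuous_fst).continuousOn).mul (ContinuousOn.inv₀ (by fun_prop) ?_)
    rintro ⟨s, x⟩ hx h0
    exact h s ((sub_eq_zero.mp h0) ▸ hx.2)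
  obtain ⟨C, hC⟩ := (isCompact_Icc.prod (spectrum.isCompact (𝕜 := ℂ) a)).exists_bound_of_continuousOn
    (hc.mono (prod_mono (subset_univ (Icc u v)) le_rfl))
  simp only [intervalIntegral.integral_of_le huv]
  rw [cfc_setIntegral measurableSet_Ioc (fun s x => g s * (γ s - x)⁻¹) (fun _ => C) a
    (hc.mono (prod_mono (subset_univ _) le_rfl)) ?_ ?_]
  · simp only [cfc_inv_sub_eq_resolvent (h _)]
  · exact ae_restrict_of_forall_mem measurableSet_Ioc
      fun s hs x hx => hC (s, x) ⟨Ioc_subset_Icc_self hs, hx⟩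
  · exact (integrable_const C).hasFiniteIntegral

/-- The Cauchy formula for the exponential of a self-adjoint element. -/
theorem rectIntegral_exp_resolvent {a : A} (ha : IsSelfAdjoint a) {K δ : ℝ} (hδ : 0 < δ)
    (hK : 0 ≤ K) (hs : spectrum ℂ a ⊆ (fun x : ℝ => (x : ℂ)) '' Ioo (-K) K) (w : ℂ) :
    rectIntegral K δ (fun z => Complex.exp (w * z) • resolvent a z)
      = (2 * Real.pi * Complex.I) • NormedSpace.exp (w • a) := by
  have := ha.isStarNormal
  have key : ∀ z : ℂ, (z.im ≠ 0 ∨ |z.re| = |K|) → z ∉ spectrum ℂ a := by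
    intro z hz h0
    obtain ⟨x, hx, rfl⟩ := hs h0
    have := abs_lt.mpr hx
    have := le_abs_self K
    simp at hz
    linarith
  have hl : cfc (fun x => Complex.exp (w * x)) a = NormedSpace.exp (w • a) := by
    rw [← CFC.complex_exp_eq_normedSpace_exp]
    exact cfc_comp_smul w Complex.exp a
  -- The scalar formula holds at each point of the spectrum; applying the functional calculus to
  -- both sides, one side of the rectangle at a time, gives the operator formula.
  have hx : (spectrum ℂ a).EqOn
      (fun x => rectIntegral K δ (fun z => Complex.exp (w * z) * (z - x)⁻¹))
      (fun x => 2 * Real.pi * Complex.I * Complex.exp (w * x)) := by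
    intro x hx
    obtain ⟨x, hxK, rfl⟩ := hs hx
    exact rectIntegral_cauchy hδ hxK.1 hxK.2 (f := fun z => Complex.exp (w * z)) (by fun_prop)
  rw [← hl, ← cfc_const_mul .., ← cfc_congr hx]
  have m1 : ∀ s : ℝ, (s : ℂ) + (-δ : ℝ) * Complex.I ∉ spectrum ℂ a :=
    fun s => key _ (Or.inl (by simpa using hδ.ne'))
  have m2 : ∀ s : ℝ, (s : ℂ) + δ * Complex.I ∉ spectrum ℂ a :=
    fun s => key _ (Or.inl (by simpa using hδ.ne'))
  have m3 : ∀ s : ℝ, (K : ℂ) + s * Complex.I ∉ spectrum ℂ a :=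
    fun s => key _ (Or.inr (by simp))
  have m4 : ∀ s : ℝ, ((-K : ℝ) : ℂ) + s * Complex.I ∉ spectrum ℂ a :=
    fun s => key _ (Or.inr (by simp))
  have c1 := continuousOn_integral_cauchyKernel (g := fun s : ℝ =>
    Complex.exp (w * ((s : ℂ) + (-δ : ℝ) * Complex.I))) (by fun_prop) (by fun_prop) m1 (-K) K
  have c2 := continuousOn_integral_cauchyKernel (g := fun s : ℝ =>
    Complex.exp (w * ((s : ℂ) + δ * Complex.I))) (by fun_prop) (by fun_prop) m2 (-K) K
  have c3 := continuousOn_integral_cauchyKernel (g := fun s : ℝ =>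
    Complex.exp (w * ((K : ℂ) + s * Complex.I))) (by fun_prop) (by fun_prop) m3 (-δ) δ
  have c4 := continuousOn_integral_cauchyKernel (g := fun s : ℝ =>
    Complex.exp (w * (((-K : ℝ) : ℂ) + s * Complex.I))) (by fun_prop) (by fun_prop) m4 (-δ) δ
  have comb : ∀ f₁ f₂ f₃ f₄ : ℂ → ℂ, ContinuousOn f₁ (spectrum ℂ a) →
      ContinuousOn f₂ (spectrum ℂ a) → ContinuousOn f₃ (spectrum ℂ a) →
      ContinuousOn f₄ (spectrum ℂ a) →
      cfc (fun x => f₁ x - f₂ x + Complex.I * f₃ x - Complex.I * f₄ x) a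
        = cfc f₁ a - cfc f₂ a + Complex.I • cfc f₃ a - Complex.I • cfc f₄ a := by
    intro f₁ f₂ f₃ f₄ h₁ h₂ h₃ h₄
    rw [cfc_sub (fun x => f₁ x - f₂ x + Complex.I * f₃ x) (fun x => Complex.I * f₄ x) a
        ((h₁.sub h₂).add (continuousOn_const.mul h₃)) (continuousOn_const.mul h₄),
      cfc_add a (fun x => f₁ x - f₂ x) (fun x => Complex.I * f₃ x) (h₁.sub h₂)
        (continuousOn_const.mul h₃), cfc_sub f₁ f₂ a h₁ h₂,
      cfc_const_mul _ f₃ a h₃, cfc_const_mul _ f₄ a h₄]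
  refine Eq.trans ?_ (comb _ _ _ _ c1 c2 c3 c4).symm
  simp only [rectIntegral]
  rw [cfc_integral_cauchyKernel (by fun_prop) (by fun_prop) m1 (by linarith),
    cfc_integral_cauchyKernel (by fun_prop) (by fun_prop) m2 (by linarith),
    cfc_integral_cauchyKernel (by fun_prop) (by fun_prop) m3 (by linarith),
    cfc_integral_cauchyKernel (by fun_prop) (by fun_prop) m4 (by linarith)]

theorem continuousAt_resolvent {a : A} {z : ℂ} (hz : z ∉ spectrum ℂ a) :
    ContinuousAt (resolvent a) z :=
  (spectrum.hasDerivAt_resolvent_const_left (spectrum.notMem_iff.mp hz)).continuousAt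

/-- For a self-adjoint element the norm equals the spectral radius. -/
theorem norm_le_of_spectrum_subset {a : A} (ha : IsSelfAdjoint a) {r : ℝ}
    (hr : 0 ≤ r) (hs : spectrum ℂ a ⊆ (fun x : ℝ => (x : ℂ)) '' Icc (-r) r) : ‖a‖ ≤ r := by
  have h : spectralRadius ℂ a ≤ ENNReal.ofReal r := by
    refine iSup₂_le fun z hz => ?_
    obtain ⟨x, hx, rfl⟩ := hs hz
    rw [← enorm_eq_nnnorm, ← ofReal_norm]
    refine ENNReal.ofReal_le_ofReal ?_
    rw [Complex.norm_real]
    exact abs_le.mpr hx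
  rw [ha.spectralRadius_eq_nnnorm, ← enorm_eq_nnnorm, ← ofReal_norm] at h
  exact (ENNReal.ofReal_le_ofReal_iff hr).mp h
end

/-! ### From the resolvent to the evolution -/

theorem ContinuousLinearMap.map_rectIntegral {E F : Type*} [NormedAddCommGroup E] [NormedSpace ℂ E]
    [NormedAddCommGroup F] [NormedSpace ℂ F] [CompleteSpace E] [CompleteSpace F]
    (L : E →L[ℂ] F) {K δ : ℝ} {f : ℂ → E} (hδ : δ ≠ 0)
    (hf : ∀ z : ℂ, (z.im ≠ 0 ∨ |z.re| = |K|) → ContinuousAt f z) :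
    L (rectIntegral K δ f) = rectIntegral K δ (fun z => L (f z)) := by
  have hc : ∀ γ : ℝ → ℂ, Continuous γ → (∀ s, (γ s).im ≠ 0 ∨ |(γ s).re| = |K|) → ∀ a b : ℝ,
      L (∫ s in a..b, f (γ s)) = ∫ s in a..b, L (f (γ s)) := by
    intro γ hγ h a b
    have : Continuous fun s => f (γ s) :=
      continuous_iff_continuousAt.mpr fun s => (hf _ (h s)).comp hγ.continuousAt
    exact (L.intervalIntegral_comp_comm (this.intervalIntegrable _ _)).symm
  simp only [rectIntegral, map_add, map_sub, map_smul]
  rw [hc (fun s => (s : ℂ) + (-δ : ℝ) * Complex.I) (by fun_prop)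
      (fun s => Or.inl (by simpa using hδ)),
    hc (fun s => (s : ℂ) + δ * Complex.I) (by fun_prop) (fun s => Or.inl (by simpa using hδ)),
    hc (fun s => (K : ℂ) + s * Complex.I) (by fun_prop) (fun s => Or.inr (by simp)),
    hc (fun s => ((-K : ℝ) : ℂ) + s * Complex.I) (by fun_prop) (fun s => Or.inr (by simp))]

/-- If matrix elements of the resolvent are bounded by `B` along the boundary of the rectangle, then
the corresponding matrix elements of `e^{-itH}` are bounded by `B e^{tδ}`, up to a constant. -/
theorem norm_evolve_apply_le {H : EllTwo →L[ℂ] EllTwo} (hH : IsSelfAdjoint H) {K δ B t : ℝ}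
    (hδ : 0 < δ) (hδ1 : δ ≤ 1) (hK : 1 ≤ K) (ht : 0 ≤ t) (hB : 0 ≤ B)
    (hs : spectrum ℂ H ⊆ (fun x : ℝ => (x : ℂ)) '' Icc (-K + 1) (K - 1)) (φ : EllTwo) (n : ℤ)
    (h1 : ∀ z : ℂ, z.im ≠ 0 → |z.re| ≤ K → |z.im| ≤ δ → (|z.re| = K ∨ |z.im| = δ) →
      ‖resolvent H z φ n‖ ≤ B) :
    ‖evolve H t φ n‖ ≤ 2 * K * Real.exp (t * δ) * B := by
  let L : (EllTwo →L[ℂ] EllTwo) →L[ℂ] ℂ :=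
    (lp.evalCLM ℂ (fun _ : ℤ => ℂ) 2 n).comp (ContinuousLinearMap.apply ℂ EllTwo φ)
  have hs' : spectrum ℂ H ⊆ (fun x : ℝ => (x : ℂ)) '' Ioo (-K) K :=
    hs.trans (image_mono fun x hx => ⟨by linarith [hx.1], by linarith [hx.2]⟩)
  have hres : ∀ z : ℂ, (z.im ≠ 0 ∨ |z.re| = |K|) → z ∉ spectrum ℂ H := by
    intro z hz h0
    obtain ⟨x, hx, rfl⟩ := hs' h0
    have := abs_lt.mpr hx
    have := le_abs_self K
    simp at hz
    linarith
  have hmap : L (rectIntegral K δ fun z => Complex.exp (-(Complex.I * t) * z) • resolvent H z)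
      = rectIntegral K δ fun z => L (Complex.exp (-(Complex.I * t) * z) • resolvent H z) := by
    refine L.map_rectIntegral hδ.ne' fun z hz => ContinuousAt.smul
      (f := fun z => Complex.exp (-(Complex.I * t) * z)) (by fun_prop) ?_
    exact continuousAt_resolvent (hres z hz)
  rw [rectIntegral_exp_resolvent hH hδ (by linarith) hs', map_smul] at hmap
  have hL : L (NormedSpace.exp ((-(Complex.I * (t : ℂ))) • H)) = evolve H t φ n := rfl
  rw [hL] at hmap
  have hb : ∀ z : ℂ, z.im ≠ 0 → |z.re| ≤ K → |z.im| ≤ δ → (|z.re| = K ∨ |z.im| = δ) →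
      ‖L (Complex.exp (-(Complex.I * t) * z) • resolvent H z)‖ ≤ Real.exp (t * δ) * B := by
    intro z hz0 hz1 hz2 hz3
    rw [map_smul, norm_smul, Complex.norm_exp]
    have hL2 : L (resolvent H z) = resolvent H z φ n := rfl
    rw [hL2]
    refine mul_le_mul (Real.exp_le_exp.mpr ?_) (h1 z hz0 hz1 hz2 hz3) (norm_nonneg _)
      (Real.exp_pos _).le
    have : (-(Complex.I * t) * z).re = t * z.im := by simp
    rw [this]
    exact mul_le_mul_of_nonneg_left ((le_abs_self _).trans hz2) ht
  have hn := norm_rectIntegral_le (K := K) (δ := δ) (B := Real.exp (t * δ) * B)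
    (f := fun z => L (Complex.exp (-(Complex.I * t) * z) • resolvent H z)) (by linarith) hδ
    (fun s h => hb _ (by simpa using hδ.ne') (by simpa using h) (by simp [abs_of_pos hδ])
      (by simp [abs_of_pos hδ]))
    (fun s h => hb _ (by simpa using hδ.ne') (by simpa using h) (by simp [abs_of_pos hδ])
      (by simp [abs_of_pos hδ]))
    (fun s h0 h => hb _ (by simpa using h0) (by simp [abs_of_nonneg (zero_le_one.trans hK)])
      (by simpa using h) (by simp [abs_of_nonneg (zero_le_one.trans hK)]))
    (fun s h0 h => hb _ (by simpa using h0) (by simp [abs_of_nonneg (zero_le_one.trans hK)])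
      (by simpa using h) (by simp [abs_of_nonneg (zero_le_one.trans hK)]))
  rw [← hmap, norm_smul] at hn
  have hpi : ‖(2 * Real.pi * Complex.I : ℂ)‖ = 2 * Real.pi := by
    simp [abs_of_pos Real.pi_pos]
  rw [hpi] at hn
  -- The constant `2K` comes from `2π ≥ 4` and the perimeter bound `4K + 4δ ≤ 8K`.
  have h4 : 4 * ‖evolve H t φ n‖ ≤ 2 * Real.pi * ‖evolve H t φ n‖ :=
    mul_le_mul_of_nonneg_right (by linarith [Real.pi_gt_three]) (norm_nonneg _)
  have h5 : (4 * K + 4 * δ) * (Real.exp (t * δ) * B) ≤ (8 * K) * (Real.exp (t * δ) * B) :=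
    mul_le_mul_of_nonneg_right (by linarith) (by positivity)
  linarith

/-! ### Cutoffs and hopping sums -/

/-- The restriction of a sequence to a set of sites, extended by zero. -/
noncomputable def cutoff (s : Set ℤ) (f : EllTwo) : EllTwo :=
  ⟨s.indicator fun n => f n, by
    refine memℓp_gen ((ellTwo_summable_sq f).of_nonneg_of_le (fun n => by positivity) fun n => ?_)
    simp only [ENNReal.toReal_ofNat]
    gcongr
    exact norm_indicator_le_norm_self _ _⟩

theorem cutoff_of_mem {s : Set ℤ} {n : ℤ} (h : n ∈ s) (f : EllTwo) : cutoff s f n = f n :=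
  indicator_of_mem h _

theorem cutoff_of_notMem {s : Set ℤ} {n : ℤ} (h : n ∉ s) (f : EllTwo) : cutoff s f n = 0 :=
  indicator_of_notMem h _

theorem cutoff_add_cutoff_compl (s : Set ℤ) (f : EllTwo) : cutoff s f + cutoff sᶜ f = f := by
  ext n
  exact congrFun (indicator_self_add_compl s fun n => f n) n

theorem norm_apply_le (f : EllTwo) (n : ℤ) : ‖f n‖ ≤ ‖f‖ :=
  lp.norm_apply_le_norm (by simp) f n

theorem hasSum_apply (H : EllTwo →L[ℂ] EllTwo) (f : EllTwo) (m : ℤ) :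
    HasSum (fun j => H (basisVec j) m * f j) (H f m) := by
  let L : EllTwo →L[ℂ] ℂ := (lp.evalCLM ℂ (fun _ : ℤ => ℂ) 2 m).comp H
  have h := (lp.hasSum_single (p := 2) (by simp) f).mapL L
  convert h using 2 with j
  · have : lp.single (E := fun _ : ℤ => ℂ) 2 j (f j) = f j • basisVec j := by
      rw [basisVec, ← lp.single_smul, smul_eq_mul, mul_one]
    rw [this, map_smul, smul_eq_mul, mul_comm]
    rfl
  · rfl

/-- `∑_l e^{-c|l|/2}`. -/
noncomputable def expSum (c : ℝ) : ℝ := ∑' l : ℤ, Real.exp (-(c / 2) * |(l : ℝ)|)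

theorem expSum_nonneg (c : ℝ) : 0 ≤ expSum c := tsum_nonneg fun _ => (Real.exp_pos _).le

theorem hasSum_exp_sub {c : ℝ} (hc : 0 < c) (m : ℤ) :
    HasSum (fun j : ℤ => Real.exp (-(c / 2) * |((j - m : ℤ) : ℝ)|)) (expSum c) :=
  (Equiv.subRight m).hasSum_iff.mpr (summable_exp_neg_abs (half_pos hc)).hasSum

/-- Off-diagonal exponential decay of the matrix elements of an operator. -/
def OffDiagDecay (H : EllTwo →L[ℂ] EllTwo) (C c : ℝ) : Prop :=
  ∀ m j : ℤ, m ≠ j → ‖H (basisVec j) m‖ ≤ C * Real.exp (-c * |((j - m : ℤ) : ℝ)|)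

/-- Half of the decay rate pays for summing over sites, and the rest is stored in `W`. The centre
`c₀` is free: it is the row `m` itself for boxes and the cut point for half-lines. -/
theorem norm_apply_cutoff_le {H : EllTwo →L[ℂ] EllTwo} {C c W : ℝ} (hc : 0 < c)
    (hW : 0 ≤ W) (hC : 0 ≤ C) (hH : OffDiagDecay H C c) {s : Set ℤ} (x : EllTwo) {m : ℤ} (c₀ : ℤ)
    (hm : m ∉ s) (h : ∀ j ∈ s, Real.exp (-c * |((j - m : ℤ) : ℝ)|) * ‖x j‖
      ≤ Real.exp (-(c / 2) * |((j - c₀ : ℤ) : ℝ)|) * W) :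
    ‖H (cutoff s x) m‖ ≤ C * W * expSum c := by
  refine (hasSum_apply H (cutoff s x) m).norm_le_of_bounded
    ((hasSum_exp_sub hc c₀).mul_left (C * W)) fun j => ?_
  by_cases hj : j ∈ s
  · rw [cutoff_of_mem hj, norm_mul]
    have h1 := hH m j (fun e => hm (e ▸ hj))
    calc _ ≤ C * Real.exp (-c * |((j - m : ℤ) : ℝ)|) * ‖x j‖ := by gcongr
      _ = C * (Real.exp (-c * |((j - m : ℤ) : ℝ)|) * ‖x j‖) := by ring
      _ ≤ C * (Real.exp (-(c / 2) * |((j - c₀ : ℤ) : ℝ)|) * W) :=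
          mul_le_mul_of_nonneg_left (h j hj) hC
      _ = _ := by ring
  · rw [cutoff_of_notMem hj]
    simp only [mul_zero, norm_zero]
    positivity

/-! ### Box matrices and the numerical range -/

/-- The sequence supported on the finite set `I` with values `u`. -/
noncomputable def extendBox {I : Finset ℤ} (u : I → ℂ) : EllTwo := ∑ i : I, u i • basisVec i

theorem basisVec_apply (i n : ℤ) : basisVec i n = if n = i then 1 else 0 := by
  rw [basisVec, lp.single_apply, Pi.single_apply]

theorem extendBox_apply {I : Finset ℤ} (u : I → ℂ) (n : ℤ) :
    extendBox u n = ∑ i : I, u i * basisVec i n :=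
  map_sum (lp.evalCLM ℂ (fun _ : ℤ => ℂ) 2 n) (fun i : I => u i • basisVec (i : ℤ))
    Finset.univ

theorem extendBox_apply_mem {I : Finset ℤ} (u : I → ℂ) (i : I) : extendBox u i = u i := by
  rw [extendBox_apply, Finset.sum_eq_single i]
  · simp [basisVec_apply]
  · intro j _ hj
    rw [basisVec_apply, if_neg fun h => hj (Subtype.ext h.symm), mul_zero]
  · simp

theorem extendBox_apply_notMem {I : Finset ℤ} (u : I → ℂ) {n : ℤ} (h : n ∉ I) :
    extendBox u n = 0 := by
  rw [extendBox_apply]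
  refine Finset.sum_eq_zero fun i _ => ?_
  have hn : n ≠ i := fun e => h (e ▸ i.2)
  rw [basisVec_apply, if_neg hn, mul_zero]

theorem boxMatrix_mulVec (H : EllTwo →L[ℂ] EllTwo) {I : Finset ℤ} (z : ℂ) (u : I → ℂ) (m : I) :
    Matrix.mulVec (boxMatrix H I - z • (1 : Matrix I I ℂ)) u m
      = (H (extendBox u) - z • extendBox u) m := by
  have h1 : H (extendBox u) m = ∑ i : I, u i * H (basisVec i) m := by
    refine (map_sum ((lp.evalCLM ℂ (fun _ : ℤ => ℂ) 2 (m : ℤ)).comp H)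
      (fun i : I => u i • basisVec (i : ℤ)) Finset.univ).trans ?_
    simp only [map_smul, smul_eq_mul]
    rfl
  have h2 : (H (extendBox u) - z • extendBox u) m
      = H (extendBox u) m - z * extendBox u m := rfl
  rw [h2, h1, extendBox_apply_mem, Matrix.sub_mulVec, Matrix.smul_mulVec, Matrix.one_mulVec]
  simp [Matrix.mulVec, dotProduct, boxMatrix, mul_comm]

/-- The numerical range of `H` has distance at least `δ` to `z`. -/
def IsNumericallyFar (H : EllTwo →L[ℂ] EllTwo) (z : ℂ) (δ : ℝ) : Prop :=
  ∀ f : EllTwo, δ * ‖f‖ ^ 2 ≤ ‖inner ℂ f (H f - z • f)‖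

theorem inner_extendBox {I : Finset ℤ} (u : I → ℂ) (g : EllTwo) :
    inner ℂ (extendBox u) g = ∑ i : I, starRingEnd ℂ (u i) * g i := by
  simp only [extendBox, sum_inner, inner_smul_left]
  refine Finset.sum_congr rfl fun i _ => ?_
  have h := lp.inner_single_left (𝕜 := ℂ) (G := fun _ : ℤ => ℂ) (i : ℤ) 1 g
  rw [basisVec, h]
  simp

/-- A kernel vector, extended by zero, has vanishing quadratic form for `H - z`, hence is zero. -/
theorem IsNumericallyFar.isUnit_boxMatrix {H : EllTwo →L[ℂ] EllTwo} {z : ℂ} {δ : ℝ} (hδ : 0 < δ)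
    (h : IsNumericallyFar H z δ) (I : Finset ℤ) :
    IsUnit (boxMatrix H I - z • (1 : Matrix I I ℂ)) := by
  rw [← Matrix.mulVec_injective_iff_isUnit]
  refine (injective_iff_map_eq_zero (Matrix.mulVecLin _)).mpr fun u hu => ?_
  have h0 : inner ℂ (extendBox u) (H (extendBox u) - z • extendBox u) = 0 := by
    rw [inner_extendBox]
    refine Finset.sum_eq_zero fun i _ => ?_
    rw [← boxMatrix_mulVec]
    have := congrFun hu i
    simp only [Matrix.mulVecLin_apply] at this
    simp [this]
  have h1 := h (extendBox u)
  rw [h0, norm_zero] at h1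
  have h2 : ‖extendBox u‖ = 0 := by
    by_contra hne
    have : 0 < ‖extendBox u‖ := lt_of_le_of_ne (norm_nonneg _) (Ne.symm hne)
    have : 0 < δ * ‖extendBox u‖ ^ 2 := by positivity
    linarith
  ext i
  have := norm_apply_le (extendBox u) i
  rw [h2, extendBox_apply_mem] at this
  simpa using this

/-- For a column `u` of the Green's function, extended by zero, `H - z` maps `u` to `δ_m` inside the
box. Hence `δ‖u‖² ≤ |u_m| ≤ ‖u‖`. -/
theorem IsNumericallyFar.norm_boxGreen_le {H : EllTwo →L[ℂ] EllTwo} {z : ℂ} {δ : ℝ} (hδ : 0 < δ)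
    (h : IsNumericallyFar H z δ) {I : Finset ℤ} (k m : I) : ‖boxGreen H I z k m‖ ≤ δ⁻¹ := by
  set u : I → ℂ := fun k => boxGreen H I z k m
  have hD : ∀ i : I, (H (extendBox u) - z • extendBox u) i = if i = m then 1 else 0 := by
    intro i
    rw [← boxMatrix_mulVec]
    have h1 : (boxMatrix H I - z • (1 : Matrix I I ℂ)) * boxGreen H I z = 1 :=
      Matrix.mul_nonsing_inv _ ((Matrix.isUnit_iff_isUnit_det _).mp (h.isUnit_boxMatrix hδ I))
    have h2 := congrFun (congrFun h1 i) m
    rw [Matrix.one_apply] at h2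
    exact h2
  have h1 := h (extendBox u)
  rw [inner_extendBox] at h1
  simp only [hD, mul_ite, mul_one, mul_zero, Finset.sum_ite_eq', Finset.mem_univ, if_true,
    RCLike.norm_conj] at h1
  have h2 := norm_apply_le (extendBox u) m
  have h3 := norm_apply_le (extendBox u) k
  rw [extendBox_apply_mem] at h2 h3
  refine h3.trans ?_
  by_contra! hlt
  have hp : 0 < ‖extendBox u‖ := (inv_pos.mpr hδ).trans hlt
  have h4 : δ * ‖extendBox u‖ ≤ 1 := by
    have : δ * ‖extendBox u‖ * ‖extendBox u‖ ≤ 1 * ‖extendBox u‖ := by nlinarith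
    exact le_of_mul_le_mul_right this hp
  rw [inv_lt_iff_one_lt_mul₀' hδ] at hlt
  linarith

theorem IsNumericallyFar.norm_le {H : EllTwo →L[ℂ] EllTwo} {z : ℂ} {δ : ℝ} (hδ : 0 < δ)
    (h : IsNumericallyFar H z δ) {x φ : EllTwo} (hx : H x - z • x = φ) : ‖x‖ ≤ δ⁻¹ * ‖φ‖ := by
  have h1 := (h x).trans (norm_inner_le_norm _ _)
  rw [hx] at h1
  rcases (norm_nonneg x).eq_or_lt with h0 | h0
  · rw [← h0]; positivity
  · rw [inv_mul_eq_div, le_div_iff₀ hδ]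
    refine le_of_mul_le_mul_right (a := ‖x‖) ?_ h0
    nlinarith

/-! ### Decay inside a box and on a half-line -/

/-- Resolvent identity on a box: inside the box, a solution is the Green's function applied to the
boundary terms. -/
theorem apply_eq_boxGreen {H : EllTwo →L[ℂ] EllTwo} {z : ℂ} {I : Finset ℤ}
    (hu : IsUnit (boxMatrix H I - z • (1 : Matrix I I ℂ))) {x φ : EllTwo}
    (hx : H x - z • x = φ) (hφ : ∀ n ∈ I, φ n = 0) (k : I) :
    x k = -∑ m : I, boxGreen H I z k m * H (cutoff (I : Set ℤ)ᶜ x) m := by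
  set u : I → ℂ := fun i => x i
  have he : extendBox u = cutoff (I : Set ℤ) x := by
    ext n
    by_cases hn : n ∈ I
    · rw [cutoff_of_mem (by simpa using hn)]
      exact extendBox_apply_mem u ⟨n, hn⟩
    · rw [cutoff_of_notMem (by simpa using hn), extendBox_apply_notMem u hn]
  have h1 : Matrix.mulVec (boxMatrix H I - z • (1 : Matrix I I ℂ)) u
      = fun m : I => -H (cutoff (I : Set ℤ)ᶜ x) m := by
    ext m
    rw [boxMatrix_mulVec, he]
    have hsplit := cutoff_add_cutoff_compl (I : Set ℤ) x
    have hx' := congrArg (fun f : EllTwo => f m) hx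
    simp only [hφ m m.2] at hx'
    rw [← hsplit, map_add] at hx'
    have e : (H (cutoff (I : Set ℤ) x) - z • cutoff (I : Set ℤ) x) (m : ℤ)
      + (H (cutoff (I : Set ℤ)ᶜ x) m - z * cutoff (I : Set ℤ)ᶜ x m) = 0 := by
      rw [← hx']
      simp only [lp.coeFn_sub, lp.coeFn_add, lp.coeFn_smul, Pi.sub_apply, Pi.add_apply,
        Pi.smul_apply, smul_eq_mul]
      ring
    rw [cutoff_of_notMem (n := (m : ℤ)) (by simp), mul_zero, sub_zero] at e
    exact eq_neg_of_add_eq_zero_left e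
  have h2 : boxGreen H I z * (boxMatrix H I - z • (1 : Matrix I I ℂ)) = 1 :=
    Matrix.nonsing_inv_mul _ ((Matrix.isUnit_iff_isUnit_det _).mp hu)
  have h3 : u = Matrix.mulVec (boxGreen H I z) (fun m : I => -H (cutoff (I : Set ℤ)ᶜ x) m) := by
    rw [← h1, Matrix.mulVec_mulVec, h2, Matrix.one_mulVec]
  have h4 := congrFun h3 k
  simpa [Matrix.mulVec, dotProduct] using h4

/-- Inside a good box, away from its boundary, solutions are exponentially small. -/
theorem IsGoodBox.norm_apply_le {H : EllTwo →L[ℂ] EllTwo} {C c δ : ℝ} (hc : 0 < c) (hC : 0 ≤ C)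
    (hδ : 0 < δ) (hδ1 : δ ≤ 1) (hH : OffDiagDecay H C c) {z : ℂ} (hz : IsNumericallyFar H z δ)
    {I : Finset ℤ} (hI : IsGoodBox H c z I) {x φ : EllTwo} (hx : H x - z • x = φ)
    (hφ : ∀ n ∈ I, φ n = 0) {c₀ : ℤ}
    (hc₀ : ∀ j : ℤ, j ∉ I → (I.card : ℝ) / 2 ≤ |((j - c₀ : ℤ) : ℝ)|) {k : ℤ}
    (hk : |((k - c₀ : ℤ) : ℝ)| ≤ I.card / 5) (hkI : k ∈ I) :
    ‖x k‖ ≤ I.card * (δ⁻¹ * (C * (‖x‖ * Real.exp (-c * I.card / 8)) * expSum c)) := by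
  have hS := expSum_nonneg c
  have hδi : 1 ≤ δ⁻¹ := (one_le_inv₀ hδ).mpr hδ1
  rw [apply_eq_boxGreen (hz.isUnit_boxMatrix hδ I) hx hφ ⟨k, hkI⟩, norm_neg]
  refine (norm_sum_le _ _).trans ?_
  refine (Finset.sum_le_card_nsmul _ _
    (δ⁻¹ * (C * (‖x‖ * Real.exp (-c * I.card / 8)) * expSum c)) fun m _ => ?_).trans (by simp)
  rw [norm_mul]
  -- Either `m` is far from `k` and the Green's function is small, or `m` is close to `k`, hence
  -- deep inside the box, and hopping from outside to `m` is small.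
  by_cases hm : (I.card : ℝ) / 20 < |(k : ℝ) - ((m : ℤ) : ℝ)|
  · have h1 := (hI ⟨k, hkI⟩ m hm).le
    have h2 := norm_apply_cutoff_le (W := ‖x‖) hc (norm_nonneg _) hC hH x (m : ℤ)
      (s := (I : Set ℤ)ᶜ) (m := m) (by simp) (fun j _ => by
        gcongr
        · linarith
        · exact _root_.norm_apply_le x j)
    have h3 : Real.exp (-c * I.card) ≤ Real.exp (-c * I.card / 8) := by
      refine Real.exp_le_exp.mpr ?_
      have : 0 ≤ c * I.card := by positivity
      linarith
    calc _ ≤ Real.exp (-c * I.card / 8) * (C * ‖x‖ * expSum c) := by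
          gcongr; exact h1.trans h3
      _ = 1 * (C * (‖x‖ * Real.exp (-c * I.card / 8)) * expSum c) := by ring
      _ ≤ _ := by gcongr
  · refine mul_le_mul (hz.norm_boxGreen_le hδ _ _) ?_ (norm_nonneg _) (by positivity)
    refine norm_apply_cutoff_le hc (by positivity) hC hH x (m : ℤ) (by simp) fun j hj => ?_
    have hj' := hc₀ j (by simpa using hj)
    -- Here `1/2 - 1/5 - 1/20 = 1/4`. Half of the decay `e^{-c|I|/4}` is kept for the sum over `j`,
    -- leaving `e^{-c|I|/8}`.
    have hd : (I.card : ℝ) / 4 ≤ |((j - m : ℤ) : ℝ)| := by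
      push_cast at *
      have t1 := abs_sub_le (j : ℝ) m c₀
      have t2 := abs_sub_le ((m : ℤ) : ℝ) k c₀
      rw [abs_sub_comm ((m : ℤ) : ℝ) k] at t2
      linarith [not_lt.mp hm]
    have h3 : Real.exp (-c * |((j - m : ℤ) : ℝ)|)
        ≤ Real.exp (-(c / 2) * |((j - m : ℤ) : ℝ)|) * Real.exp (-c * I.card / 8) := by
      rw [← Real.exp_add]
      refine Real.exp_le_exp.mpr ?_
      nlinarith
    calc _ ≤ (Real.exp (-(c / 2) * |((j - m : ℤ) : ℝ)|) * Real.exp (-c * I.card / 8)) * ‖x‖ := by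
          gcongr; exact _root_.norm_apply_le x j
      _ = _ := by ring

/-- If a solution is small near `c₀`, it is small on any half-line `B` bounded by `c₀` that does not
meet the support of the source. -/
theorem norm_cutoff_le {H : EllTwo →L[ℂ] EllTwo} {C c δ : ℝ} (hc : 0 < c) (hC : 0 ≤ C)
    (hδ : 0 < δ) (hH : OffDiagDecay H C c) {z : ℂ} (hz : IsNumericallyFar H z δ)
    {x φ : EllTwo} (hx : H x - z • x = φ) {B : Set ℤ} (hφ : ∀ n ∈ B, φ n = 0) {c₀ : ℤ}
    (hB : ∀ m ∈ B, ∀ j ∉ B,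
      |((j - m : ℤ) : ℝ)| = |((j - c₀ : ℤ) : ℝ)| + |((m - c₀ : ℤ) : ℝ)|)
    {r η : ℝ} (hη : 0 ≤ η) (hx0 : ∀ k : ℤ, |((k - c₀ : ℤ) : ℝ)| ≤ r → ‖x k‖ ≤ η) :
    ‖cutoff B x‖ ≤ δ⁻¹ * (C * expSum c ^ 2 * (η + ‖x‖ * Real.exp (-c * r / 2))) := by
  have hS := expSum_nonneg c
  set W := η + ‖x‖ * Real.exp (-c * r / 2)
  have hW0 : 0 ≤ W := by positivity
  have hv : ∀ m ∈ B, ‖(H (cutoff B x) - z • cutoff B x) m‖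
      ≤ C * (Real.exp (-(c / 2) * |((m - c₀ : ℤ) : ℝ)|) * W) * expSum c := by
    intro m hm
    have hx' := congrArg (fun f : EllTwo => f m) hx
    simp only [hφ m hm] at hx'
    rw [← cutoff_add_cutoff_compl B x, map_add] at hx'
    have e : (H (cutoff B x) - z • cutoff B x) m
      + (H (cutoff Bᶜ x) m - z * cutoff Bᶜ x m) = 0 := by
      rw [← hx']
      simp only [lp.coeFn_sub, lp.coeFn_add, lp.coeFn_smul, Pi.sub_apply, Pi.add_apply,
        Pi.smul_apply, smul_eq_mul]
      ring
    rw [cutoff_of_notMem (s := Bᶜ) (n := m) (by simpa using hm), mul_zero, sub_zero] at e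
    rw [eq_neg_of_add_eq_zero_left e, norm_neg]
    refine norm_apply_cutoff_le hc (by positivity) hC hH x c₀ (by simpa using hm) fun j hj => ?_
    rw [hB m hm j hj]
    have e1 : Real.exp (-c * (|((j - c₀ : ℤ) : ℝ)| + |((m - c₀ : ℤ) : ℝ)|))
        ≤ Real.exp (-c * |((j - c₀ : ℤ) : ℝ)|) * Real.exp (-(c / 2) * |((m - c₀ : ℤ) : ℝ)|) := by
      rw [← Real.exp_add]
      refine Real.exp_le_exp.mpr ?_
      have := mul_nonneg hc.le (abs_nonneg ((m - c₀ : ℤ) : ℝ))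
      linarith
    have e2 : Real.exp (-c * |((j - c₀ : ℤ) : ℝ)|) * ‖x j‖
        ≤ Real.exp (-(c / 2) * |((j - c₀ : ℤ) : ℝ)|) * W := by
      have hnn := mul_nonneg hc.le (abs_nonneg ((j - c₀ : ℤ) : ℝ))
      -- Within distance `r` of `c₀` the solution is at most `η`; farther away, half of the hopping
      -- decay supplies `e^{-cr/2}`.
      by_cases hj : |((j - c₀ : ℤ) : ℝ)| ≤ r
      · refine mul_le_mul (Real.exp_le_exp.mpr (by linarith)) ((hx0 j hj).trans ?_)
          (norm_nonneg _) (Real.exp_pos _).le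
        exact le_add_of_nonneg_right (by positivity)
      · calc _ ≤ (Real.exp (-(c / 2) * |((j - c₀ : ℤ) : ℝ)|) * Real.exp (-c * r / 2)) * ‖x‖ := by
              refine mul_le_mul ?_ (norm_apply_le x j) (norm_nonneg _) (by positivity)
              rw [← Real.exp_add]
              refine Real.exp_le_exp.mpr ?_
              nlinarith [not_le.mp hj]
          _ = Real.exp (-(c / 2) * |((j - c₀ : ℤ) : ℝ)|) * (‖x‖ * Real.exp (-c * r / 2)) := by ring
          _ ≤ _ := by
              gcongr
              exact le_add_of_nonneg_left hη
    calc _ ≤ Real.exp (-c * |((j - c₀ : ℤ) : ℝ)|) * Real.exp (-(c / 2) * |((m - c₀ : ℤ) : ℝ)|)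
          * ‖x j‖ := by gcongr
      _ = Real.exp (-(c / 2) * |((m - c₀ : ℤ) : ℝ)|)
          * (Real.exp (-c * |((j - c₀ : ℤ) : ℝ)|) * ‖x j‖) := by ring
      _ ≤ Real.exp (-(c / 2) * |((m - c₀ : ℤ) : ℝ)|)
          * (Real.exp (-(c / 2) * |((j - c₀ : ℤ) : ℝ)|) * W) := by gcongr
      _ = _ := by ring
  -- Pairing with the cutoff discards the values of `(H - z)(cutoff B x)` outside `B`, the only ones
  -- not covered by `hv`.
  have hin : ‖inner ℂ (cutoff B x) (H (cutoff B x) - z • cutoff B x)‖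
      ≤ ‖cutoff B x‖ * C * W * expSum c * expSum c := by
    refine (lp.hasSum_inner (𝕜 := ℂ) (G := fun _ : ℤ => ℂ) (cutoff B x) _).norm_le_of_bounded
      ((hasSum_exp_sub hc c₀).mul_left (‖cutoff B x‖ * C * W * expSum c)) fun m => ?_
    refine (norm_inner_le_norm _ _).trans ?_
    by_cases hm : m ∈ B
    · calc _ ≤ ‖cutoff B x‖
          * (C * (Real.exp (-(c / 2) * |((m - c₀ : ℤ) : ℝ)|) * W) * expSum c) :=
            mul_le_mul (norm_apply_le _ _) (hv m hm) (norm_nonneg _) (norm_nonneg _)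
        _ = _ := by ring
    · rw [cutoff_of_notMem hm, norm_zero, zero_mul]
      positivity
  have h1 := (hz (cutoff B x)).trans hin
  rcases (norm_nonneg (cutoff B x)).eq_or_lt with h0 | h0
  · rw [← h0]; positivity
  · rw [inv_mul_eq_div, le_div_iff₀ hδ]
    refine le_of_mul_le_mul_right (a := ‖cutoff B x‖) ?_ h0
    linarith

/-! ### Matrix entries and symmetry of the operator -/

theorem longRangeOp_basisVec {A : ℤ → ℂ} {C c : ℝ} (hc : 0 < c)
    (hA : ∀ m : ℤ, ‖A m‖ ≤ C * Real.exp (-c * |(m : ℝ)|)) (V : EllInfty) (m j : ℤ) :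
    longRangeOp A V (basisVec j) m = A (m - j) + if m = j then (V m : ℂ) else 0 := by
  rw [longRangeOp_apply hc hA, tsum_eq_single (m - j)]
  · simp [basisVec_apply]
  · intro l hl
    rw [basisVec_apply, if_neg (by omega), mul_zero]

theorem offDiagDecay_longRangeOp {A : ℤ → ℂ} {C c c' : ℝ} (hc' : 0 < c') (hc : c' ≤ c)
    (hA : ∀ m : ℤ, ‖A m‖ ≤ C * Real.exp (-c * |(m : ℝ)|)) (V : EllInfty) :
    OffDiagDecay (longRangeOp A V) C c' := by
  have hC : 0 ≤ C := by simpa using (norm_nonneg _).trans (hA 0)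
  intro m j hmj
  rw [longRangeOp_basisVec (hc'.trans_le hc) hA, if_neg hmj, add_zero]
  refine (hA _).trans (mul_le_mul_of_nonneg_left (Real.exp_le_exp.mpr ?_) hC)
  push_cast
  rw [abs_sub_comm]
  have := mul_le_mul_of_nonneg_right hc (abs_nonneg ((j : ℝ) - m))
  linarith

theorem inner_basisVec_left (m : ℤ) (g : EllTwo) : inner ℂ (basisVec m) g = g m := by
  rw [basisVec, lp.inner_single_left (𝕜 := ℂ) (G := fun _ : ℤ => ℂ) m 1 g]
  simp

theorem clm_ext_basisVec {S T : EllTwo →L[ℂ] EllTwo}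
    (h : ∀ m j, S (basisVec j) m = T (basisVec j) m) : S = T := by
  ext f m
  have h1 := hasSum_apply S f m
  simp only [h] at h1
  exact h1.unique (hasSum_apply T f m)

theorem isSelfAdjoint_of_conj_entries {H : EllTwo →L[ℂ] EllTwo}
    (h : ∀ m j, starRingEnd ℂ (H (basisVec j) m) = H (basisVec m) j) : IsSelfAdjoint H := by
  refine clm_ext_basisVec fun m j => ?_
  rw [← inner_basisVec_left, ContinuousLinearMap.star_eq_adjoint,
    ContinuousLinearMap.adjoint_inner_right, ← inner_conj_symm, inner_basisVec_left, h]

theorem longRangeOp_conj_entries {A : ℤ → ℂ} {C c : ℝ} (hc : 0 < c)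
    (hA : ∀ m : ℤ, ‖A m‖ ≤ C * Real.exp (-c * |(m : ℝ)|))
    (hA' : ∀ m : ℤ, starRingEnd ℂ (A m) = A (-m)) (V : EllInfty) (m j : ℤ) :
    starRingEnd ℂ (longRangeOp A V (basisVec j) m) = longRangeOp A V (basisVec m) j := by
  rw [longRangeOp_basisVec hc hA, longRangeOp_basisVec hc hA, map_add, hA', neg_sub]
  congr 1
  by_cases h : m = j
  · subst h; simp
  · rw [if_neg h, if_neg (Ne.symm h), map_zero]

/-- For Hermitian entries the Green's function at the conjugate of `z` is the adjoint of the one at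
`z`. This transfers good boxes to the half of the contour with `Im z < 0`. -/
theorem IsGoodBox.conj {H : EllTwo →L[ℂ] EllTwo} {c : ℝ} {z : ℂ} {I : Finset ℤ}
    (h : ∀ m j, starRingEnd ℂ (H (basisVec j) m) = H (basisVec m) j)
    (hI : IsGoodBox H c z I) : IsGoodBox H c (starRingEnd ℂ z) I := by
  intro m n hmn
  have e : boxMatrix H I - starRingEnd ℂ z • (1 : Matrix I I ℂ)
      = (boxMatrix H I - z • (1 : Matrix I I ℂ)).conjTranspose := by
    ext i j
    simp only [Matrix.sub_apply, Matrix.smul_apply, Matrix.conjTranspose_apply, boxMatrix,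
      Matrix.of_apply, star_sub, smul_eq_mul, star_mul', Matrix.one_apply]
    rw [← starRingEnd_apply, h, ← starRingEnd_apply]
    by_cases hij : i = j
    · simp [hij]
    · simp [hij, Ne.symm hij]
  have hn := hI n m (by rwa [abs_sub_comm])
  rw [boxGreen, e, ← Matrix.conjTranspose_nonsing_inv, Matrix.conjTranspose_apply, norm_star]
  exact hn

/-- The form of `H` is real, so the imaginary part of the form of `H - z` comes from `z` alone.
Serves the horizontal sides of the contour. -/
theorem isNumericallyFar_of_im {H : EllTwo →L[ℂ] EllTwo} (hH : IsSelfAdjoint H) {z : ℂ} {δ : ℝ}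
    (h : δ ≤ |z.im|) : IsNumericallyFar H z δ := by
  intro f
  have h1 : (inner ℂ f (H f)).im = 0 := by
    have h2 := (ContinuousLinearMap.isSelfAdjoint_iff_isSymmetric.mp hH) f f
    have h3 := inner_conj_symm (𝕜 := ℂ) f (H f)
    simp only [ContinuousLinearMap.coe_coe] at h2
    rw [h2] at h3
    exact Complex.conj_eq_iff_im.mp h3
  refine le_trans ?_ (Complex.abs_im_le_norm _)
  rw [inner_sub_right, inner_smul_right, inner_self_eq_norm_sq_to_K, Complex.sub_im, h1, zero_sub,
    abs_neg]
  have : (z * (((‖f‖ : ℝ) : ℂ)) ^ 2).im = z.im * ‖f‖ ^ 2 := by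
    rw [← Complex.ofReal_pow, Complex.im_mul_ofReal]
  simp only [Complex.coe_algebraMap]
  rw [this, abs_mul, abs_of_nonneg (sq_nonneg ‖f‖)]
  gcongr

/-- Serves the vertical sides, where `‖z‖ ≥ K` while `‖H‖ ≤ K - 1`. -/
theorem isNumericallyFar_of_norm {H : EllTwo →L[ℂ] EllTwo} {z : ℂ} {δ : ℝ}
    (h : ‖H‖ + δ ≤ ‖z‖) : IsNumericallyFar H z δ := by
  intro f
  rw [inner_sub_right, inner_smul_right, norm_sub_rev]
  have h1 : ‖inner ℂ f (H f)‖ ≤ ‖H‖ * ‖f‖ ^ 2 := by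
    refine (norm_inner_le_norm _ _).trans ?_
    nlinarith [H.le_opNorm f, norm_nonneg f]
  have h2 : ‖z * inner ℂ f f‖ = ‖z‖ * ‖f‖ ^ 2 := by
    rw [norm_mul, inner_self_eq_norm_sq_to_K]
    simp
  have h3 := norm_sub_norm_le (z * inner ℂ f f) (inner ℂ f (H f))
  rw [h2] at h3
  nlinarith [mul_le_mul_of_nonneg_right h (sq_nonneg ‖f‖)]

/-! ### Screening by a good box -/

/-- The constant in `norm_apply_le_of_goodBox`. -/
noncomputable def decayConst (C c : ℝ) : ℝ := C * expSum c ^ 2 * (C * expSum c * (40 / c) + 1)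

theorem decayConst_nonneg {C c : ℝ} (hC : 0 ≤ C) (hc : 0 < c) : 0 ≤ decayConst C c := by
  have := expSum_nonneg c
  unfold decayConst
  positivity

/-- Absorbs the factor `|I|` from the sum over the box at the price of `c/40` in the rate. -/
theorem mul_exp_neg_le {c L : ℝ} (hc : 0 < c) : L * Real.exp (-c * L / 40) ≤ 40 / c := by
  have h1 := Real.add_one_le_exp (c * L / 40)
  have h2 : Real.exp (-c * L / 40) = (Real.exp (c * L / 40))⁻¹ := by
    rw [← Real.exp_neg]; congr 1; ring
  rw [h2, ← div_eq_mul_inv, div_le_div_iff₀ (Real.exp_pos _) hc]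
  linarith

/-- A good box screens the sites behind it from a source in front of it. -/
theorem norm_apply_le_of_goodBox {H : EllTwo →L[ℂ] EllTwo} {C c δ : ℝ} (hc : 0 < c) (hC : 0 ≤ C)
    (hδ : 0 < δ) (hδ1 : δ ≤ 1) (hH : OffDiagDecay H C c) {z : ℂ} (hz : IsNumericallyFar H z δ)
    {a b : ℤ} (hI : IsGoodBox H c z (Finset.Icc a b)) (h3 : 3 ≤ (Finset.Icc a b).card)
    {x φ : EllTwo} (hx : H x - z • x = φ) {n : ℤ}
    (hn : (b ≤ n ∧ ∀ m, a ≤ m → φ m = 0) ∨ (n ≤ a ∧ ∀ m, m ≤ b → φ m = 0)) :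
    ‖x n‖ ≤ decayConst C c * δ⁻¹ ^ 3 * ‖φ‖
      * Real.exp (-(3 * c / 40) * (Finset.Icc a b).card) := by
  have hS := expSum_nonneg c
  have hδi : 1 ≤ δ⁻¹ := (one_le_inv₀ hδ).mpr hδ1
  set I := Finset.Icc a b with hIdef
  have hcard : I.card = (b + 1 - a).toNat := Int.card_Icc a b
  set L : ℝ := (I.card : ℝ) with hL
  have hL3 : (3 : ℝ) ≤ L := by rw [hL]; exact_mod_cast h3
  have hLi : ((I.card : ℤ)) = b + 1 - a := by omega
  set c₀ : ℤ := (a + b) / 2 with hc₀def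
  have hc₀ : ∀ j : ℤ, j ∉ I → (I.card : ℝ) / 2 ≤ |((j - c₀ : ℤ) : ℝ)| := by
    intro j hj
    rw [hIdef, Finset.mem_Icc] at hj
    have h2 : (I.card : ℤ) ≤ 2 * |j - c₀| := by
      rcases abs_cases (j - c₀) with h | h <;> omega
    have h2' : ((I.card : ℤ) : ℝ) ≤ ((2 * |j - c₀| : ℤ) : ℝ) := by exact_mod_cast h2
    push_cast at h2' ⊢
    linarith
  have hφI : ∀ m ∈ I, φ m = 0 := by
    intro m hm
    rw [hIdef, Finset.mem_Icc] at hm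
    rcases hn with hn | hn
    · exact hn.2 m hm.1
    · exact hn.2 m hm.2
  have hxn := hz.norm_le hδ hx
  set η : ℝ := L * (δ⁻¹ * (C * (‖x‖ * Real.exp (-c * L / 8)) * expSum c)) with hη
  have hx0 : ∀ k : ℤ, |((k - c₀ : ℤ) : ℝ)| ≤ L / 5 → ‖x k‖ ≤ η := by
    intro k hk
    refine hI.norm_apply_le hc hC hδ hδ1 hH hz hx hφI hc₀ hk ?_
    by_contra hkI
    have := hc₀ k hkI
    linarith
  have hη0 : 0 ≤ η := by positivity
  obtain ⟨B, hnB, hφB, hB⟩ : ∃ B : Set ℤ, n ∈ B ∧ (∀ m ∈ B, φ m = 0) ∧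
      ∀ m ∈ B, ∀ j ∉ B,
        |((j - m : ℤ) : ℝ)| = |((j - c₀ : ℤ) : ℝ)| + |((m - c₀ : ℤ) : ℝ)| := by
    rcases hn with hn | hn
    · refine ⟨Ioi c₀, ?_, fun m hm => hn.2 m ?_, fun m hm j hj => ?_⟩
      · simp only [mem_Ioi]; omega
      · simp only [mem_Ioi] at hm; omega
      · simp only [mem_Ioi] at hm hj
        have : |j - m| = |j - c₀| + |m - c₀| := by
          rw [abs_of_nonpos (by omega), abs_of_nonpos (by omega), abs_of_nonneg (by omega)]
          ring
        exact_mod_cast this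
    -- Since `c₀` is rounded down, `a < c₀` requires `b ≥ a + 2`; this is why the box needs three
    -- points.
    · refine ⟨Iio c₀, ?_, fun m hm => hn.2 m ?_, fun m hm j hj => ?_⟩
      · simp only [mem_Iio]; omega
      · simp only [mem_Iio] at hm; omega
      · simp only [mem_Iio] at hm hj
        have : |j - m| = |j - c₀| + |m - c₀| := by
          rw [abs_of_nonneg (by omega), abs_of_nonneg (by omega), abs_of_nonpos (by omega)]
          ring
        exact_mod_cast this
  have h1 := norm_apply_le (cutoff B x) n
  rw [cutoff_of_mem hnB] at h1
  refine (h1.trans (norm_cutoff_le hc hC hδ hH hz hx hφB hB hη0 hx0)).trans ?_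
  -- The radius `r = L/5` gives the rate `c/10 = 3c/40 + c/40`, and the `c/40` is spent on the
  -- factor `L` in `η`.
  have e1 : Real.exp (-c * (L / 5) / 2)
      = Real.exp (-(3 * c / 40) * L) * Real.exp (-c * L / 40) := by
    rw [← Real.exp_add]; congr 1; ring
  have e2 : Real.exp (-c * L / 8) ≤ Real.exp (-c * (L / 5) / 2) := by
    refine Real.exp_le_exp.mpr ?_
    have : 0 ≤ c * L := by positivity
    linarith
  have e3 : Real.exp (-c * L / 40) ≤ 1 := by
    refine Real.exp_le_one_iff.mpr ?_
    have : 0 ≤ c * L := by positivity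
    linarith
  have e4 := mul_exp_neg_le (L := L) hc
  have e5 : η ≤ δ⁻¹ * ‖x‖ * (C * expSum c * (40 / c)) * Real.exp (-(3 * c / 40) * L) := by
    calc η = δ⁻¹ * ‖x‖ * (C * expSum c) * (L * Real.exp (-c * L / 8)) := by rw [hη]; ring
      _ ≤ δ⁻¹ * ‖x‖ * (C * expSum c) * (L * Real.exp (-c * (L / 5) / 2)) := by gcongr
      _ = δ⁻¹ * ‖x‖ * (C * expSum c) * ((L * Real.exp (-c * L / 40))
          * Real.exp (-(3 * c / 40) * L)) := by rw [e1]; ring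
      _ ≤ δ⁻¹ * ‖x‖ * (C * expSum c) * ((40 / c) * Real.exp (-(3 * c / 40) * L)) := by gcongr
      _ = _ := by ring
  have e6 : ‖x‖ * Real.exp (-c * (L / 5) / 2)
      ≤ δ⁻¹ * ‖x‖ * 1 * Real.exp (-(3 * c / 40) * L) := by
    rw [e1]
    calc _ = 1 * ‖x‖ * Real.exp (-c * L / 40) * Real.exp (-(3 * c / 40) * L) := by ring
      _ ≤ _ := by gcongr
  calc _ ≤ δ⁻¹ * (C * expSum c ^ 2
        * (δ⁻¹ * ‖x‖ * (C * expSum c * (40 / c)) * Real.exp (-(3 * c / 40) * L)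
          + δ⁻¹ * ‖x‖ * 1 * Real.exp (-(3 * c / 40) * L))) := by gcongr
    _ = decayConst C c * δ⁻¹ ^ 2 * ‖x‖ * Real.exp (-(3 * c / 40) * L) := by
      unfold decayConst; ring
    _ ≤ decayConst C c * δ⁻¹ ^ 2 * (δ⁻¹ * ‖φ‖) * Real.exp (-(3 * c / 40) * L) := by
      have := decayConst_nonneg hC hc
      gcongr
    _ = _ := by ring

/-! ### Time-averaged moments and summable tails -/

theorem norm_evolve {H : EllTwo →L[ℂ] EllTwo} (hH : IsSelfAdjoint H) (t : ℝ) (φ : EllTwo) :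
    ‖evolve H t φ‖ = ‖φ‖ := by
  let a : selfAdjoint (EllTwo →L[ℂ] EllTwo) := 
    ⟨((-t : ℝ) : ℂ) • H, IsSelfAdjoint.smul (Complex.conj_ofReal _) hH⟩
  have h := ContinuousLinearMap.norm_map_of_mem_unitary (selfAdjoint.expUnitary a).2 φ
  rw [selfAdjoint.expUnitary_coe] at h
  have e : Complex.I • (a : EllTwo →L[ℂ] EllTwo) = (-(Complex.I * (t : ℂ))) • H := by
    change Complex.I • (((-t : ℝ) : ℂ) • H) = _
    rw [smul_smul]
    congr 1
    push_cast; ring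
  rw [e] at h
  exact h

theorem hasSum_norm_sq (f : EllTwo) : HasSum (fun n : ℤ => ‖f n‖ ^ 2) (‖f‖ ^ 2) := by
  have h := (ellTwo_summable_sq f).hasSum
  rw [← ellTwo_norm_sq] at h
  simpa only [Real.rpow_two] using h

/-- The growth `e^{t/T}` uses up half of the damping `e^{-2t/T}`, so its average doubles. -/
theorem lintegral_exp_mul_add_le {T P W : ℝ} (hT : 0 < T) (hP : 0 ≤ P) (hW : 0 ≤ W) :
    ENNReal.ofReal (2 / T) * ∫⁻ t in Ioi (0 : ℝ), ENNReal.ofReal (Real.exp (-2 * t / T)) *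
      ENNReal.ofReal (P + Real.exp (t / T) * W) = ENNReal.ofReal (P + 2 * W) := by
  have a1 : -2 / T < 0 := div_neg_of_neg_of_pos (by norm_num) hT
  have a2 : -1 / T < 0 := div_neg_of_neg_of_pos (by norm_num) hT
  have e : ∀ t : ℝ, Real.exp (-2 * t / T) * (P + Real.exp (t / T) * W)
      = Real.exp (-2 / T * t) * P + Real.exp (-1 / T * t) * W := by
    intro t
    rw [mul_add, ← mul_assoc, ← Real.exp_add]
    congr 3 <;> [ring_nf; ring_nf]
  have i1 := (integrableOn_exp_mul_Ioi a1 0).mul_const P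
  have i2 := (integrableOn_exp_mul_Ioi a2 0).mul_const W
  have i3 : Integrable (fun t => Real.exp (-2 / T * t) * P + Real.exp (-1 / T * t) * W)
      (volume.restrict (Ioi 0)) := i1.add i2
  have h : ∫⁻ t in Ioi (0 : ℝ), ENNReal.ofReal (Real.exp (-2 * t / T)) *
      ENNReal.ofReal (P + Real.exp (t / T) * W) = ENNReal.ofReal (T / 2 * P + T * W) := by
    simp only [← ENNReal.ofReal_mul (Real.exp_pos _).le, e]
    rw [← ofReal_integral_eq_lintegral_ofReal i3 (ae_of_all _ fun t => by positivity),
      integral_add i1 i2, integral_mul_const, integral_mul_const, integral_exp_mul_Ioi a1,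
      integral_exp_mul_Ioi a2]
    congr 1
    simp only [mul_zero, Real.exp_zero]
    field_simp
  rw [h, ← ENNReal.ofReal_mul (by positivity)]
  congr 1
  field_simp

/-- By unitarity `‖ψ(t)‖ = ‖φ‖`, so the part with constant weight `Q` contributes `Q‖φ‖²`. -/
theorem averagedMoment_le {H : EllTwo →L[ℂ] EllTwo} (hH : IsSelfAdjoint H) {p T Q W : ℝ}
    (hT : 0 < T) (hQ : 0 ≤ Q) {φ : EllTwo} {w : ℤ → ℝ} (hw0 : ∀ n, 0 ≤ w n) (hw : HasSum w W)
    (h : ∀ t : ℝ, 0 < t → ∀ n : ℤ, |(n : ℝ)| ^ p * ‖evolve H t φ n‖ ^ 2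
      ≤ Q * ‖evolve H t φ n‖ ^ 2 + Real.exp (t / T) * w n) :
    averagedMoment H p φ T ≤ ENNReal.ofReal (Q * ‖φ‖ ^ 2 + 2 * W) := by
  rw [← lintegral_exp_mul_add_le hT (by positivity) (hw.nonneg hw0), averagedMoment]
  refine mul_le_mul' le_rfl (setLIntegral_mono' measurableSet_Ioi fun t ht => mul_le_mul' le_rfl ?_)
  have hs : HasSum (fun n => Q * ‖evolve H t φ n‖ ^ 2 + Real.exp (t / T) * w n)
      (Q * ‖φ‖ ^ 2 + Real.exp (t / T) * W) := by
    have h1 := hasSum_norm_sq (evolve H t φ)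
    rw [norm_evolve hH] at h1
    exact (h1.mul_left Q).add (hw.mul_left _)
  rw [← hs.tsum_eq, ENNReal.ofReal_tsum_of_nonneg (fun n => ?_) hs.summable]
  · exact ENNReal.tsum_le_tsum fun n => ENNReal.ofReal_le_ofReal (h t ht n)
  · have := hw0 n
    positivity

/-- A summable weight on `ℤ` dominating the squared tails of the wave packet. -/
noncomputable def tailWeight (p c C : ℝ) (n : ℤ) : ℝ :=
  |(n : ℝ)| ^ p * Real.exp (-(c / 40) * Real.log |((2 * n : ℤ) : ℝ)| ^ C) ^ 2

theorem tailWeight_nonneg (p c C : ℝ) (n : ℤ) : 0 ≤ tailWeight p c C n := by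
  unfold tailWeight
  positivity

/-- As `C > 1`, `(log 2n)^C` eventually exceeds any multiple of `log 2n`; the multiple `(|p| + 2) ·
20/c` makes the weight at most `n⁻²`. -/
theorem summable_tailWeight {p c C : ℝ} (hc : 0 < c) (hC : 1 < C) :
    Summable (tailWeight p c C) := by
  have key : Summable fun n : ℕ => tailWeight p c C n := by
    refine Summable.of_norm_bounded_eventually_nat (g := fun n : ℕ => (n : ℝ) ^ (-2 : ℝ))
      (Real.summable_nat_rpow.mpr (by norm_num)) ?_
    have hlog : Filter.Tendsto (fun n : ℕ => Real.log (2 * n)) Filter.atTop Filter.atTop :=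
      Real.tendsto_log_atTop.comp
        (tendsto_natCast_atTop_atTop.const_mul_atTop (by norm_num : (0 : ℝ) < 2))
    have hpow := (tendsto_rpow_atTop (sub_pos.mpr hC)).comp hlog
    filter_upwards [hpow.eventually_ge_atTop ((|p| + 2) * (20 / c)), Filter.eventually_ge_atTop 1]
      with n hn hn1
    have hn1' : (1 : ℝ) ≤ n := by exact_mod_cast hn1
    have hn0 : (0 : ℝ) < n := by linarith
    have hl0 : 0 < Real.log (2 * n) := Real.log_pos (by linarith)
    have hln : Real.log n ≤ Real.log (2 * n) := Real.log_le_log hn0 (by linarith)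
    have hln0 : 0 ≤ Real.log n := Real.log_nonneg hn1'
    rw [Real.norm_of_nonneg (tailWeight_nonneg _ _ _ _)]
    unfold tailWeight
    have e1 : |((2 * (n : ℤ) : ℤ) : ℝ)| = 2 * n := by
      push_cast; rw [abs_of_nonneg (by positivity)]
    have e2 : |(((n : ℤ)) : ℝ)| = n := by simp
    rw [e1, e2, Real.rpow_def_of_pos hn0, Real.rpow_def_of_pos hn0, ← Real.exp_nat_mul,
      ← Real.exp_add]
    refine Real.exp_le_exp.mpr ?_
    have e3 : Real.log (2 * n) ^ C = Real.log (2 * n) ^ (C - 1) * Real.log (2 * n) := by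
      rw [← Real.rpow_add_one hl0.ne', sub_add_cancel]
    have e4 : (|p| + 2) * Real.log (2 * n) ≤ c / 20 * Real.log (2 * n) ^ C := by
      rw [e3]
      have : (|p| + 2) * (20 / c) * Real.log (2 * n)
          ≤ Real.log (2 * n) ^ (C - 1) * Real.log (2 * n) :=
        mul_le_mul_of_nonneg_right hn hl0.le
      calc _ = c / 20 * ((|p| + 2) * (20 / c) * Real.log (2 * n)) := by field_simp
        _ ≤ _ := mul_le_mul_of_nonneg_left this (by positivity)
    have e5 : Real.log n * p ≤ Real.log n * |p| :=
      mul_le_mul_of_nonneg_left (le_abs_self p) hln0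
    have e6 : (|p| + 2) * Real.log n ≤ (|p| + 2) * Real.log (2 * n) :=
      mul_le_mul_of_nonneg_left hln (by positivity)
    push_cast
    linarith
  refine Summable.of_nat_of_neg key ?_
  have e : ∀ n : ℕ, tailWeight p c C (-n) = tailWeight p c C n := fun n => by simp [tailWeight]
  simpa only [e] using key

/-! ### Dynamical localization beyond the scale `R` -/

theorem resolvent_apply_eq {H : EllTwo →L[ℂ] EllTwo} {z : ℂ} (hz : z ∉ spectrum ℂ H)
    (φ : EllTwo) : H (resolvent H z φ) - z • resolvent H z φ = -φ := by
  have h1 := Ring.mul_inverse_cancel _ (spectrum.notMem_iff.mp hz)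
  have h2 := congrArg (fun S : EllTwo →L[ℂ] EllTwo => S φ) h1
  have h3 : (algebraMap ℂ (EllTwo →L[ℂ] EllTwo) z - H) (resolvent H z φ) = φ := h2
  have h4 : (algebraMap ℂ (EllTwo →L[ℂ] EllTwo) z - H) (resolvent H z φ)
      = z • resolvent H z φ - H (resolvent H z φ) := by
    simp [Algebra.algebraMap_eq_smul_one]
  rw [← neg_sub, ← h4, h3]

theorem card_Icc_le_of_isBetween {a b N : ℤ} (h : IsBetween a b N) :
    ((Finset.Icc a b).card : ℝ) ≤ |(N : ℝ)| / 4 + 1 := by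
  rw [Int.card_Icc]
  rcases le_or_gt (b + 1 - a) 0 with h0 | h0
  · rw [Int.toNat_of_nonpos h0]
    push_cast; positivity
  · have e : (((b + 1 - a).toNat : ℕ) : ℝ) = b + 1 - a := by
      have : ((b + 1 - a).toNat : ℤ) = b + 1 - a := Int.toNat_of_nonneg h0.le
      exact_mod_cast this
    rw [e]
    rcases h with ⟨hN, h1, h2⟩ | ⟨hN, h1, h2⟩
    · have : (0 : ℝ) < N := by exact_mod_cast hN
      rw [abs_of_pos this]; linarith
    · have : (N : ℝ) < 0 := by exact_mod_cast hN
      rw [abs_of_neg this]; linarith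

/-- Dynamical consequence of good boxes: if at every energy some good box of size at least `M`
separates `n` from the support of `φ`, then `ψ_n(t)` is exponentially small in `M`. -/
theorem norm_evolve_apply_le_of_goodBox {H : EllTwo →L[ℂ] EllTwo} {C c δ K t M : ℝ} (hc : 0 < c)
    (hC : 0 ≤ C) (hδ : 0 < δ) (hδ1 : δ ≤ 1) (hK : 1 ≤ K) (ht : 0 ≤ t) (hdecay : OffDiagDecay H C c)
    (hH : IsSelfAdjoint H)
    (hs : spectrum ℂ H ⊆ (fun x : ℝ => (x : ℂ)) '' Icc (-K + 1) (K - 1)) {φ : EllTwo} {n : ℤ}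
    (hbox : ∀ z : ℂ, z.im ≠ 0 → |z.re| ≤ K → |z.im| ≤ δ → ∃ a b : ℤ,
      IsGoodBox H c z (Finset.Icc a b) ∧ 3 ≤ (Finset.Icc a b).card ∧
      M ≤ (Finset.Icc a b).card ∧
      ((b ≤ n ∧ ∀ m, a ≤ m → φ m = 0) ∨ (n ≤ a ∧ ∀ m, m ≤ b → φ m = 0))) :
    ‖evolve H t φ n‖ ≤ 2 * K * Real.exp (t * δ)
      * (decayConst C c * δ⁻¹ ^ 3 * ‖φ‖ * Real.exp (-(3 * c / 40) * M)) := by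
  have hD := decayConst_nonneg hC hc
  have hnorm : ‖H‖ ≤ K - 1 := by
    refine norm_le_of_spectrum_subset hH (by linarith) ?_
    rwa [show -(K - 1) = -K + 1 by ring]
  refine norm_evolve_apply_le hH hδ hδ1 hK ht (by positivity) hs φ n fun z h0 h1 h2 h3 => ?_
  have hfar : IsNumericallyFar H z δ := by
    rcases h3 with h3 | h3
    · refine isNumericallyFar_of_norm ?_
      have := Complex.abs_re_le_norm z
      linarith
    · exact isNumericallyFar_of_im hH h3.ge
  have hz : z ∉ spectrum ℂ H := by
    intro hz
    obtain ⟨x, -, rfl⟩ := hs hz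
    simp at h0
  obtain ⟨a, b, hgood, hcard, hM, hside⟩ := hbox z h0 h1 h2
  have h := norm_apply_le_of_goodBox hc hC hδ hδ1 hdecay hfar hgood hcard
    (resolvent_apply_eq hz φ) (n := n) (by
      refine hside.imp (And.imp_right fun h m hm => ?_) (And.imp_right fun h m hm => ?_) <;>
      · rw [lp.coeFn_neg, Pi.neg_apply, h m hm, neg_zero])
  rw [norm_neg] at h
  refine h.trans ?_
  have : 0 ≤ 3 * c / 40 := by positivity
  refine mul_le_mul_of_nonneg_left (Real.exp_le_exp.mpr ?_) (by positivity)
  nlinarith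

theorem exists_support_bound {φ : EllTwo} (hφ : (Function.support fun n : ℤ => φ n).Finite) :
    ∃ s : ℝ, 0 ≤ s ∧ ∀ m : ℤ, s < |(m : ℝ)| → φ m = 0 := by
  obtain ⟨s, hs⟩ := (hφ.image fun n : ℤ => |(n : ℝ)|).bddAbove
  refine ⟨max s 0, le_max_right _ _, fun m hm => ?_⟩
  by_contra h
  have := hs (mem_image_of_mem _ (show m ∈ Function.support fun n : ℤ => φ n from h))
  exact absurd (this.trans (le_max_left s 0)) (not_le.mpr hm)

/-- The scale `R = Γ(y)` is at least of order `y`, since good boxes in `[N/4, N/2]` have at most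
`N/4 + 1` points. -/
theorem scale_bounds {Ψ Γ : ℝ → ℝ} {N₀ : ℕ} {y : ℝ} (hy : (N₀ : ℝ) + 3 ≤ y)
    (hΨ : StrictMonoOn Ψ (Ici (N₀ : ℝ))) (hΓ : MapsTo Γ (Ici (Ψ N₀)) (Ici (N₀ : ℝ)))
    (hinv : InvOn Γ Ψ (Ici (N₀ : ℝ)) (Ici (Ψ N₀)))
    (hcard : ∀ N : ℤ, (N₀ : ℤ) ≤ |N| → Ψ |(N : ℝ)| ≤ |(N : ℝ)| / 4 + 1) :
    (N₀ : ℝ) ≤ Γ y ∧ Ψ (Γ y) = y ∧ 4 * y - 5 ≤ Γ y := by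
  have hN₀ : (0 : ℝ) ≤ N₀ := N₀.cast_nonneg
  have hyΨ : Ψ N₀ ≤ y := by
    have := hcard N₀ (le_abs_self _)
    simp only [Int.cast_natCast, Nat.abs_cast] at this
    linarith
  have hRN : (N₀ : ℝ) ≤ Γ y := hΓ hyΨ
  have hΨR : Ψ (Γ y) = y := hinv.2 hyΨ
  refine ⟨hRN, hΨR, ?_⟩
  -- The size bound is known only at integers, so it is applied to the ceiling of `Γ y` and pulled
  -- back by monotonicity.
  have hceil : (N₀ : ℝ) ≤ (⌈Γ y⌉ : ℝ) := hRN.trans (Int.le_ceil _)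
  have hceil0 : (0 : ℝ) ≤ (⌈Γ y⌉ : ℝ) := by linarith
  have h1 := hcard ⌈Γ y⌉ ((by exact_mod_cast hceil : (N₀ : ℤ) ≤ ⌈Γ y⌉).trans (le_abs_self _))
  rw [abs_of_nonneg hceil0] at h1
  have h2 := hΨ.monotoneOn hRN hceil (Int.le_ceil _)
  have h3 := (Int.ceil_lt_add_one (Γ y)).le
  linarith

/-- Beyond the scale `R`, the solution is exponentially small up to time `T`. -/
theorem norm_evolve_apply_le_tail {H : EllTwo →L[ℂ] EllTwo} {C c K ε₀ T R s α : ℝ} {Ψ : ℝ → ℝ}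
    {N₀ : ℕ} (hc : 0 < c) (hC : 0 ≤ C) (hK : 1 ≤ K) (hdecay : OffDiagDecay H C c)
    (hconj : ∀ m j, starRingEnd ℂ (H (basisVec j) m) = H (basisVec m) j)
    (hspec : spectrum ℂ H ⊆ (fun x : ℝ => (x : ℂ)) '' Icc (-K + 1) (K - 1))
    (hΨ : StrictMonoOn Ψ (Ici (N₀ : ℝ)))
    (hlog : ∀ N : ℤ, (N₀ : ℤ) ≤ |N| → Real.log |(N : ℝ)| ^ α ≤ Ψ |(N : ℝ)|)
    (hbox : ∀ N : ℤ, (N₀ : ℤ) ≤ |N| → ∀ E ε : ℝ, |E| ≤ K → 0 < ε → ε ≤ ε₀ →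
      ∃ a b : ℤ, IsBetween a b N ∧ Ψ |(N : ℝ)| ≤ (Finset.Icc a b).card ∧
        IsGoodBox H c (E + ε * Complex.I) (Finset.Icc a b))
    (hT1 : 1 ≤ T) (hTε : 1 / (2 * T) ≤ ε₀) (hRN : (N₀ : ℝ) ≤ R)
    (hΨR : Ψ R = 80 / c * Real.log T) (hR3 : 3 ≤ Ψ R) {φ : EllTwo}
    (hs : ∀ m : ℤ, s < |(m : ℝ)| → φ m = 0) (hRs : s < R / 4) {t : ℝ} (ht : 0 ≤ t) {n : ℤ}
    (hn : R / 2 ≤ |(n : ℝ)|) :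
    ‖evolve H t φ n‖ ≤ 16 * K * decayConst C c * ‖φ‖ * T⁻¹ * Real.exp (t * (1 / (2 * T)))
        * Real.exp (-(c / 40) * Real.log |((2 * n : ℤ) : ℝ)| ^ α) := by
  have hT0 : 0 < T := by linarith
  have hδ : 0 < 1 / (2 * T) := by positivity
  have hδ1 : 1 / (2 * T) ≤ 1 := by
    rw [div_le_one (by positivity)]; linarith
  have hn2 : |((2 * n : ℤ) : ℝ)| = 2 * |(n : ℝ)| := by
    push_cast; rw [abs_mul, abs_two]
  have hRn : R ≤ |((2 * n : ℤ) : ℝ)| := by rw [hn2]; linarith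
  have hNn : (N₀ : ℤ) ≤ |2 * n| := by
    have : (N₀ : ℝ) ≤ |((2 * n : ℤ) : ℝ)| := hRN.trans hRn
    exact_mod_cast this
  have hΨn : Ψ R ≤ Ψ |((2 * n : ℤ) : ℝ)| :=
    hΨ.monotoneOn hRN (hRN.trans hRn : (N₀ : ℝ) ≤ _) hRn
  have hΨl := hlog (2 * n) hNn
  refine (norm_evolve_apply_le_of_goodBox (M := Ψ |((2 * n : ℤ) : ℝ)|) hc hC hδ hδ1
    hK ht hdecay (isSelfAdjoint_of_conj_entries hconj) hspec fun z h0 h1 h2 => ?_).trans ?_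
  -- With `N = 2n` the box lies in `[n/2, n]` or its mirror image: it reaches no further out than
  -- `n` and stays outside `|m| < R/4`, which contains the support of `φ`.
  · obtain ⟨a, b, hab, hcard, hgood⟩ := hbox (2 * n) hNn z.re |z.im| h1 (abs_pos.mpr h0)
      (h2.trans hTε)
    have hgood' : IsGoodBox H c z (Finset.Icc a b) := by
      rcases abs_cases z.im with ⟨h, -⟩ | ⟨h, -⟩
      · rwa [h, Complex.re_add_im] at hgood
      · have := hgood.conj hconj
        rwa [h, show starRingEnd ℂ ((z.re : ℂ) + ((-z.im : ℝ) : ℂ) * Complex.I) = z by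
          apply Complex.ext <;> simp] at this
    refine ⟨a, b, hgood', ?_, hcard, ?_⟩
    · have : (3 : ℝ) ≤ (Finset.Icc a b).card := by linarith
      exact_mod_cast this
    · rcases hab with ⟨hN, ha, hb⟩ | ⟨hN, ha, hb⟩
      · have hn0 : (0 : ℝ) < n := by exact_mod_cast (by omega : 0 < n)
        rw [abs_of_pos hn0] at hn
        push_cast at ha hb
        refine Or.inl ⟨?_, fun m hm => hs m ?_⟩
        · have : (b : ℝ) ≤ n := by linarith
          exact_mod_cast this
        · have : (a : ℝ) ≤ m := by exact_mod_cast hm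
          exact lt_of_lt_of_le (by linarith) (le_abs_self _)
      · have hn0 : (n : ℝ) < 0 := by exact_mod_cast (by omega : n < 0)
        rw [abs_of_neg hn0] at hn
        push_cast at ha hb
        refine Or.inr ⟨?_, fun m hm => hs m ?_⟩
        · have : (n : ℝ) ≤ a := by linarith
          exact_mod_cast this
        · have : (m : ℝ) ≤ b := by exact_mod_cast hm
          exact lt_of_lt_of_le (by linarith) (neg_le_abs _)
  · have e1 : Real.exp (-(3 * c / 40) * Ψ |((2 * n : ℤ) : ℝ)|)
        ≤ T⁻¹ ^ 4 * Real.exp (-(c / 40) * Real.log |((2 * n : ℤ) : ℝ)| ^ α) := by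
      have : T⁻¹ ^ 4 = Real.exp (-(c / 20) * Ψ R) := by
        rw [hΨR, show -(c / 20) * (80 / c * Real.log T) = (4 : ℕ) * (-Real.log T) by
          push_cast; field_simp; ring, Real.exp_nat_mul, Real.exp_neg, Real.exp_log hT0]
      rw [this, ← Real.exp_add]
      refine Real.exp_le_exp.mpr ?_
      nlinarith
    have hD0 : 0 ≤ decayConst C c := decayConst_nonneg hC hc
    have hδi : (1 / (2 * T))⁻¹ = 2 * T := by rw [one_div, inv_inv]
    rw [hδi]
    calc _ ≤ 2 * K * Real.exp (t * (1 / (2 * T))) * (decayConst C c * (2 * T) ^ 3 * ‖φ‖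
          * (T⁻¹ ^ 4 * Real.exp (-(c / 40) * Real.log |((2 * n : ℤ) : ℝ)| ^ α))) := by gcongr
      _ = _ := by field_simp; ring

/-! ### Assembly of the transport bound -/

theorem theorem3p1
    -- the data on which the threshold time is allowed to depend
    (φ : EllTwo) (hφ : (Function.support fun n : ℤ => φ n).Finite)
    (K C₁ C₂ c₁ c₂ ε₀ p : ℝ) (N₀ : ℕ)
    (hK : 3 ≤ K) (hC₂ : 1 < C₂) (hc₂ : 0 < c₂) (hc : c₂ ≤ c₁)
    (hε₀ : 0 < ε₀) (hp : 0 < p) (hN₀ : 0 < N₀) :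
    ∃ T₀ : ℝ, 0 < T₀ ∧
      ∀ (A : ℤ → ℂ) (V : EllInfty) (Ψ Γ : ℝ → ℝ),
        (∀ m : ℤ, starRingEnd ℂ (A m) = A (-m)) →
        (∀ m : ℤ, ‖A m‖ ≤ C₁ * Real.exp (-c₁ * |(m : ℝ)|)) →
        spectrum ℂ (longRangeOp A V) ⊆ (fun x : ℝ => (x : ℂ)) '' Icc (-K + 1) (K - 1) →
        -- `Ψ` is increasing on `[N₀, ∞)`, and `Γ : [Ψ(N₀), ∞) → [N₀, ∞)` is its inverse
        StrictMonoOn Ψ (Ici (N₀ : ℝ)) →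
        MapsTo Γ (Ici (Ψ N₀)) (Ici (N₀ : ℝ)) →
        InvOn Γ Ψ (Ici (N₀ : ℝ)) (Ici (Ψ N₀)) →
        (∀ N : ℤ, (N₀ : ℤ) ≤ |N| → Real.log |(N : ℝ)| ^ C₂ ≤ Ψ |(N : ℝ)|) →
        (∀ N : ℤ, (N₀ : ℤ) ≤ |N| → ∀ E ε : ℝ, |E| ≤ K → 0 < ε → ε ≤ ε₀ →
          ∃ a b : ℤ, IsBetween a b N ∧
            Ψ |(N : ℝ)| ≤ (Finset.Icc a b).card ∧
            IsGoodBox (longRangeOp A V) c₂ (E + ε * Complex.I) (Finset.Icc a b)) →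
        ∀ T : ℝ, T₀ ≤ T →
          averagedMoment (longRangeOp A V) p φ T ≤
            ENNReal.ofReal (‖φ‖ ^ 2 * Γ (80 / c₂ * Real.log T) ^ p) := by
  obtain ⟨s, hs0, hs⟩ := exists_support_bound hφ
  obtain ⟨S, hSsum⟩ := summable_tailWeight (p := p) hc₂ hC₂
  have hS0 : 0 ≤ S := hSsum.nonneg fun n => tailWeight_nonneg _ _ _ _
  obtain ⟨D, hD⟩ : ∃ D, D = decayConst C₁ c₂ := ⟨_, rfl⟩
  have hq : 0 < 1 - (2 : ℝ)⁻¹ ^ p := sub_pos.mpr (Real.rpow_lt_one (by norm_num) (by norm_num) hp)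
  -- The factor is `512 = 2 · 16²`: the tail constant `16` squared, doubled by the time average. The
  -- denominator is the relative gap between `R^p` and `(R/2)^p`.
  obtain ⟨T₁, hT₁⟩ : ∃ T₁, T₁ = 512 * K ^ 2 * D ^ 2 * S / (1 - (2 : ℝ)⁻¹ ^ p) := ⟨_, rfl⟩
  have hT₁0 : 0 ≤ T₁ := hT₁ ▸ by positivity
  -- The summands ensure, in turn, `T ≥ 1`, `δ ≤ ε₀`, a scale `R` beyond `N₀` and four times the
  -- support radius, and a negligible tail.
  refine ⟨1 + 1 / (2 * ε₀) + Real.exp ((N₀ + s + 3) * (c₂ / 80)) + T₁, by positivity, ?_⟩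
  intro A V Ψ Γ hA' hA hspec hΨ hΓ hinv hlog hbox T hT
  have hC₁ : 0 ≤ C₁ := by simpa using (norm_nonneg _).trans (hA 0)
  have hc₁ : 0 < c₁ := hc₂.trans_le hc
  have hexp := Real.exp_pos ((N₀ + s + 3) * (c₂ / 80))
  have hε₁ : 0 < 1 / (2 * ε₀) := by positivity
  have hT1 : 1 ≤ T := by linarith
  have hT0 : 0 < T := by linarith
  have hTε : 1 / (2 * ε₀) ≤ T := by linarith
  have hTT : T₁ ≤ T := by linarith
  have hconj := longRangeOp_conj_entries hc₁ hA hA' V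
  have hdecay := offDiagDecay_longRangeOp hc₂ hc hA V
  obtain ⟨y, hy⟩ : ∃ y, y = 80 / c₂ * Real.log T := ⟨_, rfl⟩
  have hyT : N₀ + s + 3 ≤ y := by
    have h1 : (N₀ + s + 3) * (c₂ / 80) ≤ Real.log T :=
      (Real.le_log_iff_exp_le hT0).mpr (by linarith)
    calc N₀ + s + 3 = 80 / c₂ * ((N₀ + s + 3) * (c₂ / 80)) := by field_simp
      _ ≤ 80 / c₂ * Real.log T := mul_le_mul_of_nonneg_left h1 (by positivity)
      _ = y := hy.symm
  have hN₀r : (1 : ℝ) ≤ N₀ := by exact_mod_cast hN₀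
  obtain ⟨hRN, hΨR, hRy⟩ := scale_bounds (by linarith) hΨ hΓ hinv (y := y) (fun N hN => by
    -- Any single spectral parameter suffices to bound `Ψ` by the maximal size of a box.
    obtain ⟨a, b, h1, h2, -⟩ := hbox N hN 0 ε₀ (by simp; linarith) hε₀ le_rfl
    exact h2.trans (card_Icc_le_of_isBetween h1))
  rw [← hy]
  generalize Γ y = R at hRN hΨR hRy ⊢
  have hR1 : 1 ≤ R := hN₀r.trans hRN
  have hδε : 1 / (2 * T) ≤ ε₀ := by
    rw [div_le_iff₀ (by positivity)] at hTε ⊢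
    linarith
  have htail := fun (t : ℝ) (ht : 0 < t) (n : ℤ) (hn : R / 2 ≤ |(n : ℝ)|) =>
    norm_evolve_apply_le_tail hc₂ hC₁ (by linarith) hdecay hconj hspec hΨ hlog hbox hT1 hδε hRN
      (hΨR.trans hy) (by linarith) hs (by linarith) ht.le hn
  rw [← hD] at htail
  let w : ℤ → ℝ := fun n => 256 * K ^ 2 * D ^ 2 * ‖φ‖ ^ 2 * T⁻¹ ^ 2 * tailWeight p c₂ C₂ n
  have hw0 : ∀ n, 0 ≤ w n := fun n => mul_nonneg (by positivity) (tailWeight_nonneg _ _ _ _)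
  have hw : HasSum w (256 * K ^ 2 * D ^ 2 * ‖φ‖ ^ 2 * T⁻¹ ^ 2 * S) := hSsum.mul_left _
  have hpt : ∀ t : ℝ, 0 < t → ∀ n : ℤ, |(n : ℝ)| ^ p * ‖evolve (longRangeOp A V) t φ n‖ ^ 2
      ≤ (R / 2) ^ p * ‖evolve (longRangeOp A V) t φ n‖ ^ 2 + Real.exp (t / T) * w n := by
    intro t ht n
    have hwn := mul_nonneg (Real.exp_pos (t / T)).le (hw0 n)
    rcases lt_or_ge |(n : ℝ)| (R / 2) with hn | hn
    · refine le_add_of_le_of_nonneg (mul_le_mul_of_nonneg_right ?_ (sq_nonneg _)) hwn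
      exact Real.rpow_le_rpow (abs_nonneg _) hn.le hp.le
    · refine le_add_of_nonneg_of_le (by positivity) ?_
      have h1 := pow_le_pow_left₀ (norm_nonneg _) (htail t ht n hn) 2
      have h2 : Real.exp (t / T) = Real.exp (t * (1 / (2 * T))) ^ 2 := by
        rw [← Real.exp_nat_mul]
        congr 1
        push_cast; field_simp
      refine (mul_le_mul_of_nonneg_left h1 (Real.rpow_nonneg (abs_nonneg _) _)).trans_eq ?_
      rw [h2]
      simp only [w, tailWeight]
      ring
  have hmom := averagedMoment_le (isSelfAdjoint_of_conj_entries hconj) hT0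
    (Real.rpow_nonneg (by linarith) p) hw0 hw hpt
  refine hmom.trans (ENNReal.ofReal_le_ofReal ?_)
  have hfin : 512 * K ^ 2 * D ^ 2 * S * T⁻¹ ^ 2 ≤ 1 - (2 : ℝ)⁻¹ ^ p := by
    rw [hT₁, div_le_iff₀ hq] at hTT
    rw [inv_pow, ← div_eq_mul_inv, div_le_iff₀ (by positivity)]
    nlinarith [mul_nonneg hq.le (mul_nonneg hT0.le (sub_nonneg.mpr hT1))]
  have hRp : (R / 2) ^ p = R ^ p * (2 : ℝ)⁻¹ ^ p := by
    rw [div_eq_mul_inv, Real.mul_rpow (by linarith) (by norm_num)]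
  have hRp1 : 1 ≤ R ^ p := Real.one_le_rpow hR1 hp.le
  calc (R / 2) ^ p * ‖φ‖ ^ 2 + 2 * (256 * K ^ 2 * D ^ 2 * ‖φ‖ ^ 2 * T⁻¹ ^ 2 * S)
      = ‖φ‖ ^ 2 * ((R / 2) ^ p + 512 * K ^ 2 * D ^ 2 * S * T⁻¹ ^ 2) := by ring
    _ ≤ ‖φ‖ ^ 2 * (R ^ p * (2 : ℝ)⁻¹ ^ p + R ^ p * (1 - (2 : ℝ)⁻¹ ^ p)) := by
        rw [hRp]
        exact mul_le_mul_of_nonneg_left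
          (add_le_add le_rfl (hfin.trans (le_mul_of_one_le_left hq.le hRp1))) (sq_nonneg _)
    _ = ‖φ‖ ^ 2 * R ^ p := by ring
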